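/- Let $q\in\mathbb C^*$ with $q^2\neq 1$, and for $s\in\mathbb C$ let $q^{s}$ be the principal power. Let $g:\mathbb C^*\to\mathbb C^*$ be any function (for instance an analytic one) with $g(z)=g(z^{-1})^{-1}$ for all $z$. Let $R$ be a commutative $\mathbb C$-algebra of coefficients, and let $\delta:\mathbb C^*\to R$ be supported at $1$, i.e. $\delta(z)=0$ for $z\ne 1$. **The functional algebra.** $U_q(g,f\mathfrak s)$ is the family $(U_c)_{c\in\mathbb C}$ of $\mathbb Z/2$-graded associative unital $R$-algebras indexed by the value $c$ of its central element (which acts on $U_c$ as the scalar $c$, so that $q^{sc}$ acts as the scalar $q^{sc}$). Here $U_c$ is generated by $x^{\pm}(z)$, $\varphi(z)^{\pm1}$, $\psi(z)^{\pm1}$, $z\in\mathbb C^*$, where $x^\pm(z)$ are odd and the other generators are even, subject to the relations, for all $z,w\in\mathbb C^*$ ($\varphi(z)^{-1}$, $\psi(z)^{-1}$ being two-sided inverses): $$\varphi(z)\varphi(w)=\varphi(w)\varphi(z),\qquad \psi(z)\psi(w)=\psi(w)\psi(z),\qquad \varphi(z)\psi(w)\varphi(z)^{-1}\psi(w)^{-1}=\frac{g(\frac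 zw q^{-c})}{g(\frac zw q^{c})},$$ $$\varphi(z)x^{\pm}(w)\varphi(z)^{-1}=g(\tfrac zw q^{\mp c/2})^{\pm1}x^{\pm}(w),\qquad \psi(z)x^{\pm}(w)\psi(z)^{-1}=g(\tfrac wz q^{\mp c/2})^{\mp1}x^{\pm}(w),$$ $$x^+(z)x^-(w)+x^-(w)x^+(z)=\frac1{q-q^{-1}}\Bigl(\delta(\tfrac zw q^{-c})\,\psi(wq^{c/2})-\delta(\tfrac zw q^{c})\,\varphi(zq^{c/2})\Bigr),$$ $$x^{\pm}(z)x^{\pm}(w)=-g(\tfrac zw)^{\pm1}x^{\pm}(w)x^{\pm}(z).$$ Tensor products carry the graded multiplication $(a\otimes b)(a'\otimes b')=(-1)^{[b][a']}aa'\otimes bb'$ for homogeneous elements. **Theorem.** $U_q(g,f\mathfrak s)$ has a graded Hopf algebra structure: there are even $R$-algebra homomorphisms $\Delta:U_{c_1+c_2}\to U_{c_1}\otimes_R U_{c_2}$ (for all $c_1,c_2\in\mathbb C$) and $\varepsilon:U_0\to R$, and even $R$-linear maps $a:U_{-c}\to U_{c}$ (for all $c\in\mathbb C$) with $a(uv)=(-1)^{[u][v]}a(v)a(u)$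 for homogeneous $u,v$, such that * $(\Delta\otimes\mathrm{id})\Delta=(\mathrm{id}\otimes\Delta)\Delta$ as maps $U_{c_1+c_2+c_3}\to U_{c_1}\otimes U_{c_2}\otimes U_{c_3}$, * $(\varepsilon\otimes\mathrm{id})\Delta=\mathrm{id}=(\mathrm{id}\otimes\varepsilon)\Delta$ on every $U_c$, * $m(a\otimes\mathrm{id})\Delta=\varepsilon(\cdot)1=m(\mathrm{id}\otimes a)\Delta$ on $U_0$, where $\Delta:U_0\to U_{c_1}\otimes U_{c_2}$ for any $c_1+c_2=0$, and which are given by the following formulas. *Coproduct* (with $c_1=c\otimes1$, $c_2=1\otimes c$): $\Delta(c)=c_1+c_2$, $\Delta(q^{sc})=q^{sc}\otimes q^{sc}$ for $s\in\mathbb C$, and $$\Delta(x^+(z))=x^+(z)\otimes1+\varphi(zq^{c_1/2})\otimes x^+(zq^{c_1}),\qquad \Delta(x^-(z))=1\otimes x^-(z)+x^-(zq^{c_2})\otimes\psi(zq^{c_2/2}),$$ $$\Delta(\varphi(z))=\varphi(zq^{-c_2/2})\otimes\varphi(zq^{c_1/2}),\qquad \Delta(\psi(z))=\psi(zq^{c_2/2})\otimes\psi(zq^{-c_1/2}).$$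 *Counit*: $\varepsilon(c)=0$, $\varepsilon(q^{sc})=1$, $\varepsilon(\varphi(z))=\varepsilon(\psi(z))=1$, $\varepsilon(x^\pm(z))=0$. *Antipode* ($c$ on the right being the central element of the target): $a(c)=-c$, $a(q^{sc})=q^{-sc}$, and $$a(x^+(z))=-\varphi(zq^{-c/2})^{-1}x^+(zq^{-c}),\qquad a(x^-(z))=-x^-(zq^{-c})\psi(zq^{-c/2})^{-1},$$ $$a(\varphi(z))=\varphi(z)^{-1},\qquad a(\psi(z))=\psi(z)^{-1}.$$ -/

import Mathlib

open scoped TensorProduct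

universe u

/-! ### Graded Hopf structures on functional superalgebras

A functional superalgebra is a family `A c` of `ℤ/2`-graded algebras indexed by the value `c : ℂ` of
its central element; an element of it is a function of `c`, with value in `A c` at `c`. On a tensor
product of two copies the central elements `c₁ = c ⊗ 1` and `c₂ = 1 ⊗ c` take values independently,
and the value of `c` under the coproduct is `c₁ + c₂`, under the counit `0`, under the antipode
`-c`. -/

/-- The total `ℤ/2`-degree on a graded tensor product: the part of degree `n` is spanned by the
`a ⊗ b` with `a`, `b` homogeneous and `deg a + deg b = n`. -/
noncomputable def tensorDegree {R : Type u} [CommRing R] {A B : Type u} [Ring A] [Ring B] [Algebra R A]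
    [Algebra R B] (𝒜 : ZMod 2 → Submodule R A) (ℬ : ZMod 2 → Submodule R B)
    [GradedAlgebra 𝒜] [GradedAlgebra ℬ] (n : ZMod 2) : Submodule R (𝒜 ᵍ⊗[R] ℬ) :=
  Submodule.span R {t | ∃ (i j : ZMod 2) (a : A) (b : B),
    i + j = n ∧ a ∈ 𝒜 i ∧ b ∈ ℬ j ∧ t = GradedTensorProduct.tmul R a b}

/-- A graded Hopf structure on the functional superalgebra `(A c)_{c : ℂ}`. The multiplication of
`𝒜 c₁ ᵍ⊗[R] 𝒜 c₂` is `(a ⊗ b) (a' ⊗ b') = (-1) ^ (deg b * deg a') (a a' ⊗ b b')`. -/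
structure GradedHopfStructure (R : Type u) [CommRing R] (A : ℂ → Type u)
    [∀ c, Ring (A c)] [∀ c, Algebra R (A c)] (𝒜 : ∀ c, ZMod 2 → Submodule R (A c))
    [∀ c, GradedAlgebra (𝒜 c)] where
  /-- The coproduct, at the values `c₁` and `c₂` of the two central elements. -/
  comul : ∀ (c c₁ c₂ : ℂ), c = c₁ + c₂ → (A c →ₐ[R] 𝒜 c₁ ᵍ⊗[R] 𝒜 c₂)
  /-- The counit. -/
  counit : A 0 →ₐ[R] R
  /-- The antipode; `c'` is the value of the central element in the target. -/
  antipode : ∀ (c c' : ℂ), c = -c' → (A c →ₗ[R] A c')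
  /-- The coproduct is even. -/
  comul_mem : ∀ (c c₁ c₂ : ℂ) (h : c = c₁ + c₂) (i : ZMod 2) (a : A c), a ∈ 𝒜 c i →
    comul c c₁ c₂ h a ∈ tensorDegree (𝒜 c₁) (𝒜 c₂) i
  /-- The counit is even. -/
  counit_odd : ∀ a : A 0, a ∈ 𝒜 0 1 → counit a = 0
  /-- The antipode is even. -/
  antipode_mem : ∀ (c c' : ℂ) (h : c = -c') (i : ZMod 2) (a : A c), a ∈ 𝒜 c i →
    antipode c c' h a ∈ 𝒜 c' i
  /-- Coassociativity. -/
  coassoc : ∀ (c c₁ c₂ c₃ c₁₂ c₂₃ : ℂ) (h₁₂ : c₁₂ = c₁ + c₂) (h₂₃ : c₂₃ = c₂ + c₃)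
    (h : c = c₁₂ + c₃) (h' : c = c₁ + c₂₃) (a : A c),
    TensorProduct.assoc R (A c₁) (A c₂) (A c₃)
      (TensorProduct.map
        ((GradedTensorProduct.of R (𝒜 c₁) (𝒜 c₂)).symm.toLinearMap ∘ₗ
          (comul c₁₂ c₁ c₂ h₁₂).toLinearMap) LinearMap.id
        ((GradedTensorProduct.of R (𝒜 c₁₂) (𝒜 c₃)).symm (comul c c₁₂ c₃ h a))) =
      TensorProduct.map LinearMap.id
        ((GradedTensorProduct.of R (𝒜 c₂) (𝒜 c₃)).symm.toLinearMap ∘ₗ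
          (comul c₂₃ c₂ c₃ h₂₃).toLinearMap)
        ((GradedTensorProduct.of R (𝒜 c₁) (𝒜 c₂₃)).symm (comul c c₁ c₂₃ h' a))
  /-- `(ε ⊗ id) ∘ Δ = id`. -/
  counit_left : ∀ (c : ℂ) (h : c = 0 + c) (a : A c),
    TensorProduct.lid R (A c) (TensorProduct.map counit.toLinearMap LinearMap.id
      ((GradedTensorProduct.of R (𝒜 0) (𝒜 c)).symm (comul c 0 c h a))) = a
  /-- `(id ⊗ ε) ∘ Δ = id`. -/
  counit_right : ∀ (c : ℂ) (h : c = c + 0) (a : A c),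
    TensorProduct.rid R (A c) (TensorProduct.map LinearMap.id counit.toLinearMap
      ((GradedTensorProduct.of R (𝒜 c) (𝒜 0)).symm (comul c c 0 h a))) = a
  /-- `m ∘ (S ⊗ id) ∘ Δ = η ∘ ε`. -/
  antipode_left : ∀ (c₁ c₂ : ℂ) (h : 0 = c₁ + c₂) (h' : c₁ = -c₂) (a : A 0),
    LinearMap.mul' R (A c₂) (TensorProduct.map (antipode c₁ c₂ h') LinearMap.id
      ((GradedTensorProduct.of R (𝒜 c₁) (𝒜 c₂)).symm (comul 0 c₁ c₂ h a))) =
      algebraMap R (A c₂) (counit a)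
  /-- `m ∘ (id ⊗ S) ∘ Δ = η ∘ ε`. -/
  antipode_right : ∀ (c₁ c₂ : ℂ) (h : 0 = c₁ + c₂) (h' : c₂ = -c₁) (a : A 0),
    LinearMap.mul' R (A c₁) (TensorProduct.map LinearMap.id (antipode c₂ c₁ h')
      ((GradedTensorProduct.of R (𝒜 c₁) (𝒜 c₂)).symm (comul 0 c₁ c₂ h a))) =
      algebraMap R (A c₁) (counit a)
  /-- The antipode is a graded anti-homomorphism. -/
  antipode_mul : ∀ (c c' : ℂ) (h : c = -c') (i j : ZMod 2) (a b : A c), a ∈ 𝒜 c i → b ∈ 𝒜 c j →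
    antipode c c' h (a * b) = ((-1 : ℤˣ) ^ (i * j)) • (antipode c c' h b * antipode c c' h a)

/-! ### The functional superalgebra -/

namespace FunctionalSuperalgebra

/-- `q ^ s` for a complex exponent `s`. -/
noncomputable def qPow (q : ℂˣ) (s : ℂ) : ℂˣ :=
  Units.mk0 ((q : ℂ) ^ s) (fun h => q.ne_zero ((Complex.cpow_eq_zero_iff _ _).1 h).1)

/-- The generators `x⁺(z)`, `x⁻(z)`, `φ(z)`, `ψ(z)` and the inverses of `φ(z)`, `ψ(z)`. -/
inductive Gen : Type
  | xPlus (z : ℂˣ)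
  | xMinus (z : ℂˣ)
  | phi (z : ℂˣ)
  | phiInv (z : ℂˣ)
  | psi (z : ℂˣ)
  | psiInv (z : ℂˣ)

open Gen in
/-- The defining relations at the value `c` of the central element. Complex scalars act through
`algebraMap ℂ R`; the `R`-valued function `δ` is supported at `1` in all uses. -/
inductive Rel {R : Type u} [CommRing R] [Algebra ℂ R] (q : ℂˣ) (g : ℂˣ → ℂˣ) (δ : ℂˣ → R) (c : ℂ) :
    FreeAlgebra R Gen → FreeAlgebra R Gen → Prop
  | phi_mul_phiInv (z : ℂˣ) : Rel q g δ c
      (FreeAlgebra.ι R (phi z) * FreeAlgebra.ι R (phiInv z)) 1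
  | phiInv_mul_phi (z : ℂˣ) : Rel q g δ c
      (FreeAlgebra.ι R (phiInv z) * FreeAlgebra.ι R (phi z)) 1
  | psi_mul_psiInv (z : ℂˣ) : Rel q g δ c
      (FreeAlgebra.ι R (psi z) * FreeAlgebra.ι R (psiInv z)) 1
  | psiInv_mul_psi (z : ℂˣ) : Rel q g δ c
      (FreeAlgebra.ι R (psiInv z) * FreeAlgebra.ι R (psi z)) 1
  | phi_phi (z w : ℂˣ) : Rel q g δ c
      (FreeAlgebra.ι R (phi z) * FreeAlgebra.ι R (phi w))
      (FreeAlgebra.ι R (phi w) * FreeAlgebra.ι R (phi z))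
  | psi_psi (z w : ℂˣ) : Rel q g δ c
      (FreeAlgebra.ι R (psi z) * FreeAlgebra.ι R (psi w))
      (FreeAlgebra.ι R (psi w) * FreeAlgebra.ι R (psi z))
  | phi_psi (z w : ℂˣ) : Rel q g δ c
      (FreeAlgebra.ι R (phi z) * FreeAlgebra.ι R (psi w) *
        FreeAlgebra.ι R (phiInv z) * FreeAlgebra.ι R (psiInv w))
      (algebraMap R _ (algebraMap ℂ R
        ((g (z / w * qPow q (-c)) / g (z / w * qPow q c) : ℂˣ) : ℂ)))
  | phi_xPlus (z w : ℂˣ) : Rel q g δ c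
      (FreeAlgebra.ι R (phi z) * FreeAlgebra.ι R (xPlus w) * FreeAlgebra.ι R (phiInv z))
      (algebraMap ℂ R (g (z / w * qPow q (-(c / 2))) : ℂˣ) • FreeAlgebra.ι R (xPlus w))
  | phi_xMinus (z w : ℂˣ) : Rel q g δ c
      (FreeAlgebra.ι R (phi z) * FreeAlgebra.ι R (xMinus w) * FreeAlgebra.ι R (phiInv z))
      (algebraMap ℂ R ((g (z / w * qPow q (c / 2)))⁻¹ : ℂˣ) • FreeAlgebra.ι R (xMinus w))
  | psi_xPlus (z w : ℂˣ) : Rel q g δ c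
      (FreeAlgebra.ι R (psi z) * FreeAlgebra.ι R (xPlus w) * FreeAlgebra.ι R (psiInv z))
      (algebraMap ℂ R ((g (w / z * qPow q (-(c / 2))))⁻¹ : ℂˣ) • FreeAlgebra.ι R (xPlus w))
  | psi_xMinus (z w : ℂˣ) : Rel q g δ c
      (FreeAlgebra.ι R (psi z) * FreeAlgebra.ι R (xMinus w) * FreeAlgebra.ι R (psiInv z))
      (algebraMap ℂ R (g (w / z * qPow q (c / 2)) : ℂˣ) • FreeAlgebra.ι R (xMinus w))
  | xPlus_xMinus (z w : ℂˣ) : Rel q g δ c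
      (FreeAlgebra.ι R (xPlus z) * FreeAlgebra.ι R (xMinus w) +
        FreeAlgebra.ι R (xMinus w) * FreeAlgebra.ι R (xPlus z))
      (algebraMap ℂ R (1 / ((q : ℂ) - (q : ℂ)⁻¹)) •
        (δ (z / w * qPow q (-c)) • FreeAlgebra.ι R (psi (w * qPow q (c / 2))) -
          δ (z / w * qPow q c) • FreeAlgebra.ι R (phi (z * qPow q (c / 2)))))
  | xPlus_xPlus (z w : ℂˣ) : Rel q g δ c
      (FreeAlgebra.ι R (xPlus z) * FreeAlgebra.ι R (xPlus w))
      (-(algebraMap ℂ R (g (z / w) : ℂˣ) •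
        (FreeAlgebra.ι R (xPlus w) * FreeAlgebra.ι R (xPlus z))))
  | xMinus_xMinus (z w : ℂˣ) : Rel q g δ c
      (FreeAlgebra.ι R (xMinus z) * FreeAlgebra.ι R (xMinus w))
      (-(algebraMap ℂ R ((g (z / w))⁻¹ : ℂˣ) •
        (FreeAlgebra.ι R (xMinus w) * FreeAlgebra.ι R (xMinus z))))

/-- The algebra of values at `c` of the functional superalgebra `U_q(g, fs)`, with coefficients in
`R`. -/
def U {R : Type u} [CommRing R] [Algebra ℂ R] (q : ℂˣ) (g : ℂˣ → ℂˣ) (δ : ℂˣ → R) (c : ℂ) :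
    Type u :=
  RingQuot (Rel q g δ c)

section

variable {R : Type u} [CommRing R] [Algebra ℂ R] (q : ℂˣ) (g : ℂˣ → ℂˣ) (δ : ℂˣ → R) (c : ℂ)

instance : Ring (U q g δ c) := inferInstanceAs (Ring (RingQuot (Rel q g δ c)))

instance : Algebra R (U q g δ c) := inferInstanceAs (Algebra R (RingQuot (Rel q g δ c)))

/-- The quotient map from the free algebra. -/
def toU : FreeAlgebra R Gen →ₐ[R] U q g δ c := RingQuot.mkAlgHom R (Rel q g δ c)

theorem toU_rel {a b : FreeAlgebra R Gen} (h : Rel q g δ c a b) :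
    toU q g δ c a = toU q g δ c b := RingQuot.mkAlgHom_rel R h

/-- The image of a generator in the quotient. -/
def mk (x : Gen) : U q g δ c := toU q g δ c (FreeAlgebra.ι R x)

/-- The universal property of the quotient. -/
def lift {B : Type u} [Ring B] [Algebra R B] (f : FreeAlgebra R Gen →ₐ[R] B)
    (hf : ∀ ⦃a b⦄, Rel q g δ c a b → f a = f b) : U q g δ c →ₐ[R] B :=
  RingQuot.liftAlgHom R ⟨f, hf⟩

theorem lift_toU {B : Type u} [Ring B] [Algebra R B] (f : FreeAlgebra R Gen →ₐ[R] B)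
    (hf : ∀ ⦃a b⦄, Rel q g δ c a b → f a = f b) (a : FreeAlgebra R Gen) :
    lift q g δ c f hf (toU q g δ c a) = f a :=
  RingQuot.liftAlgHom_mkAlgHom_apply R f hf a

theorem toU_surjective : Function.Surjective (toU q g δ c) :=
  RingQuot.mkAlgHom_surjective R (Rel q g δ c)

/-- The element `x⁺(z)`. -/
def xPlus (z : ℂˣ) : U q g δ c := mk q g δ c (.xPlus z)

/-- The element `x⁻(z)`. -/
def xMinus (z : ℂˣ) : U q g δ c := mk q g δ c (.xMinus z)

/-- The invertible element `φ(z)`. -/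
def phi (z : ℂˣ) : (U q g δ c)ˣ where
  val := mk q g δ c (.phi z)
  inv := mk q g δ c (.phiInv z)
  val_inv := by
    simpa [mk] using toU_rel q g δ c (Rel.phi_mul_phiInv z)
  inv_val := by
    simpa [mk] using toU_rel q g δ c (Rel.phiInv_mul_phi z)

/-- The invertible element `ψ(z)`. -/
def psi (z : ℂˣ) : (U q g δ c)ˣ where
  val := mk q g δ c (.psi z)
  inv := mk q g δ c (.psiInv z)
  val_inv := by
    simpa [mk] using toU_rel q g δ c (Rel.psi_mul_psiInv z)
  inv_val := by
    simpa [mk] using toU_rel q g δ c (Rel.psiInv_mul_psi z)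

/-- The central element `c`. -/
def central : U q g δ c := algebraMap R _ (algebraMap ℂ R c)

/-- The central element `q ^ (s c)`, for a number `s`. -/
noncomputable def qPowCentral (s : ℂ) : U q g δ c :=
  algebraMap R _ (algebraMap ℂ R (qPow q (s * c) : ℂˣ))

/-- The parity of a generator as a sign: `x⁺(z)`, `x⁻(z)` are odd, the others even. -/
def Gen.sign (R : Type u) [CommRing R] : Gen → R
  | .xPlus _ => -1
  | .xMinus _ => -1
  | _ => 1

/-- The parity automorphism: `-1` on `x⁺(z)`, `x⁻(z)` and `1` on the other generators. -/
def parity : U q g δ c →ₐ[R] U q g δ c :=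
  lift q g δ c (FreeAlgebra.lift R (fun x => Gen.sign R x • mk q g δ c x)) (by
    intro a b h
    have key := toU_rel q g δ c h
    cases h <;>
      simp only [map_mul, map_add, map_sub, map_neg, map_one, map_smul, AlgHom.commutes,
        FreeAlgebra.lift_ι_apply, Gen.sign, mk, neg_smul, one_smul, neg_mul, mul_neg, neg_neg,
        smul_neg] at key ⊢ <;>
      first
        | exact key
        | rw [key])

theorem parity_mk (x : Gen) : parity q g δ c (mk q g δ c x) = Gen.sign R x • mk q g δ c x := by
  rw [parity, mk, lift_toU, FreeAlgebra.lift_ι_apply, mk]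

theorem parity_parity (a : U q g δ c) : parity q g δ c (parity q g δ c a) = a := by
  obtain ⟨a, rfl⟩ := toU_surjective q g δ c a
  have : ((parity q g δ c).comp (parity q g δ c)).comp (toU q g δ c) = toU q g δ c := by
    ext x
    change parity q g δ c (parity q g δ c (mk q g δ c x)) = mk q g δ c x
    rw [parity_mk, map_smul, parity_mk]
    cases x <;> simp [Gen.sign]
  exact DFunLike.congr_fun this a

/-- The `ℤ/2`-grading in which `x⁺(z)`, `x⁻(z)` have degree `1` and the other generators degree
`0`: the even and the odd part are the eigenspaces of the parity automorphism. -/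
def grading (i : ZMod 2) : Submodule R (U q g δ c) where
  carrier := {a | parity q g δ c a = ((-1 : ℤˣ) ^ i) • a}
  add_mem' := by
    intro a b ha hb
    simp only [Set.mem_ofPred_eq] at *
    rw [map_add, ha, hb, smul_add]
  zero_mem' := by simp
  smul_mem' := by
    intro r a ha
    simp only [Set.mem_ofPred_eq] at *
    rw [map_smul, ha, smul_comm]

theorem mem_grading (i : ZMod 2) (a : U q g δ c) :
    a ∈ grading q g δ c i ↔ parity q g δ c a = ((-1 : ℤˣ) ^ i) • a := Iff.rfl

/-- One half of a ring element. -/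
noncomputable def half : R := algebraMap ℂ R (1 / 2)

theorem half_add_half : (half + half : R) = 1 := by
  rw [half, ← map_add]
  norm_num

/-- The projection `a ↦ (a + (-1) ^ i σ a) / 2` onto the part of degree `i`. -/
noncomputable def proj (i : ZMod 2) : U q g δ c →ₗ[R] grading q g δ c i :=
  LinearMap.codRestrict _
    ((half : R) • (LinearMap.id + ((-1 : ℤˣ) ^ i) • (parity q g δ c).toLinearMap)) (by
      intro a
      have h := parity_parity q g δ c a
      rw [mem_grading]
      rcases Int.units_eq_one_or ((-1 : ℤˣ) ^ i) with hi | hi <;>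
        simp [hi, h, add_comm, ← smul_neg])

theorem coe_proj (i : ZMod 2) (a : U q g δ c) :
    (proj q g δ c i a : U q g δ c) = (half : R) • (a + ((-1 : ℤˣ) ^ i) • parity q g δ c a) := rfl

theorem proj_add_proj (a : U q g δ c) :
    ((proj q g δ c 0 a : U q g δ c) + (proj q g δ c 1 a : U q g δ c)) = a := by
  have h : (half : R) • a + (half : R) • a = a := by
    rw [← add_smul, half_add_half, one_smul]
  rw [coe_proj, coe_proj, uzpow_zero, uzpow_one, one_smul, Units.neg_smul, one_smul, smul_add,
    smul_add, smul_neg]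
  calc _ = (half : R) • a + (half : R) • a := by abel
    _ = a := h

theorem proj_same (i : ZMod 2) (a : grading q g δ c i) :
    (proj q g δ c i (a : U q g δ c) : U q g δ c) = a := by
  have h : (half : R) • (a : U q g δ c) + (half : R) • (a : U q g δ c) = a := by
    rw [← add_smul, half_add_half, one_smul]
  have ha := (mem_grading q g δ c i a).1 a.2
  rw [coe_proj, ha, smul_smul, Int.units_mul_self, one_smul, smul_add, h]

noncomputable instance : GradedAlgebra (grading q g δ c) where
  one_mem := by rw [mem_grading]; simp
  mul_mem := by
    intro i j a b ha hb
    rw [mem_grading] at *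
    rw [map_mul, ha, hb, smul_mul_smul_comm, uzpow_add]
  toDecomposition := DirectSum.Decomposition.ofLinearMap _
    (DirectSum.lof R _ (fun i => grading q g δ c i) 0 ∘ₗ proj q g δ c 0 +
      DirectSum.lof R _ (fun i => grading q g δ c i) 1 ∘ₗ proj q g δ c 1)
    (by
      ext a
      simpa using proj_add_proj q g δ c a)
    (by
      refine DirectSum.linearMap_ext R fun i => LinearMap.ext fun a => ?_
      have hi : ∀ i : ZMod 2, i = 0 ∨ i = 1 := by decide
      have hs := proj_add_proj q g δ c (a : U q g δ c)
      have h0 : proj q g δ c i (a : U q g δ c) = a := Subtype.ext (proj_same q g δ c i a)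
      obtain rfl | rfl := hi i
      · have h1 : proj q g δ c 1 (a : U q g δ c) = 0 :=
          Subtype.ext (by rw [h0] at hs; simpa using hs)
        simp [h0, h1]
      · have h1 : proj q g δ c 0 (a : U q g δ c) = 0 :=
          Subtype.ext (by rw [h0] at hs; simpa using hs)
        simp [h0, h1])

theorem xPlus_mem (z : ℂˣ) : xPlus q g δ c z ∈ grading q g δ c 1 := by
  rw [mem_grading, xPlus, parity_mk]; simp [Gen.sign]

theorem xMinus_mem (z : ℂˣ) : xMinus q g δ c z ∈ grading q g δ c 1 := by
  rw [mem_grading, xMinus, parity_mk]; simp [Gen.sign]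

theorem phi_mem (z : ℂˣ) : (phi q g δ c z : U q g δ c) ∈ grading q g δ c 0 := by
  rw [mem_grading, phi, parity_mk]; simp [Gen.sign]

theorem psi_mem (z : ℂˣ) : (psi q g δ c z : U q g δ c) ∈ grading q g δ c 0 := by
  rw [mem_grading, psi, parity_mk]; simp [Gen.sign]

end

end FunctionalSuperalgebra

/-! Since every `U q g δ c` is given by generators and relations, the coproduct and the counit exist
as soon as the proposed images satisfy those relations (`comulGen_isRealization`,
`counitGen_isRealization`). For the coproduct the shifts by powers of `q` are tuned so that the
scalars telescope: a value of `g` coming from one tensor leg cancels one coming from the other, and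
in the anticommutator of the images of `x⁺` and `x⁻` the two mixed terms `δ · φ ⊗ ψ`, one from each
leg, are identical with opposite signs. The symmetry `g z = (g z⁻¹)⁻¹` enters only in the quadratic
relations `x⁺x⁺` and `x⁻x⁻`.

The antipode is a graded anti-homomorphism, to which the universal property does not apply directly.
But `R` contains the imaginary unit `i`, and multiplying by `(-i) ^ deg` absorbs the sign `(-1) ^
(deg u * deg v)`. The result is an ordinary homomorphism into the opposite algebra
(`antiGen_isRealization`), from which the antipode is recovered by putting the factor `i` back on
the odd part.

Each Hopf axiom concerns a linear map `f` such as `Δ ⊗ id`, `ε ⊗ id` or `m ∘ (a ⊗ id)`, which is not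
treated as multiplicative. The axiom is therefore strengthened to a statement on how `f (Δ(a) * u)`
depends on `f u`, for all `u`. The strengthened statement is stable under sums and products in `a`,
so generators suffice; `u = 1` gives the axiom. The generator computations are
`exists_left_mul_comulGen` for coassociativity, and `antipodeLeft_comulGen_mul` and
`antipodeRight_mul_comulGen` for the antipode.

Koszul signs are carried by the parity automorphism `σ`: for odd `b`, `(a ⊗ b) (a' ⊗ b') = a σ(a') ⊗
b b'` with `a'` arbitrary, so tensors need not be split into homogeneous parts each time. -/

namespace FunctionalSuperalgebra

/-! ### Powers of `q` -/

theorem qPow_add (q : ℂˣ) (s t : ℂ) : qPow q (s + t) = qPow q s * qPow q t :=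
  Units.ext (Complex.cpow_add s t q.ne_zero)

theorem qPow_zero (q : ℂˣ) : qPow q 0 = 1 :=
  Units.ext (Complex.cpow_zero _)

theorem qPow_neg (q : ℂˣ) (s : ℂ) : qPow q (-s) = (qPow q s)⁻¹ :=
  eq_inv_of_mul_eq_one_left (by rw [← qPow_add, neg_add_cancel, qPow_zero])

theorem mul_qPow_mul_qPow (q z : ℂˣ) (s t : ℂ) :
    z * qPow q s * qPow q t = z * qPow q (s + t) := by
  rw [qPow_add, mul_assoc]

theorem mul_qPow_div (q z w : ℂˣ) (s : ℂ) : z * qPow q s / w = z / w * qPow q s :=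
  mul_div_right_comm _ _ _

theorem div_mul_qPow (q z w : ℂˣ) (s : ℂ) : z / (w * qPow q s) = z / w * qPow q (-s) := by
  rw [qPow_neg, div_mul_eq_div_div, div_eq_mul_inv (z / w)]

theorem mul_qPow_eq_self (q z : ℂˣ) {s : ℂ} (hs : s = 0) : z * qPow q s = z := by
  rw [hs, qPow_zero, mul_one]

/-! ### Commutation up to a scalar -/

section Conj

variable {R A : Type*} [CommRing R] [Ring A] [Algebra R A] {a a' x y : A}

theorem mul_eq_smul_mul_of_conj {r : R} (ha : a' * a = 1) (h : a * x * a' = r • y) :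
    a * x = r • (y * a) := by
  rw [← smul_mul_assoc, ← h, mul_assoc, ha, mul_one]

theorem mul_eq_smul_mul_of_conj_inv {r s : R} (ha : a' * a = 1) (hrs : s * r = 1)
    (h : a * x * a' = r • x) : x * a = s • (a * x) := by
  rw [mul_eq_smul_mul_of_conj ha h, smul_smul, hrs, one_smul]

end Conj

section Scalar

variable (R : Type u) [CommRing R] [Algebra ℂ R]

/-- A nonzero complex number as a scalar in `R`. -/
def scal (u : ℂˣ) : R := algebraMap ℂ R u

theorem scal_mul (u v : ℂˣ) : scal R u * scal R v = scal R (u * v) := by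
  simp [scal]

theorem scal_one : scal R 1 = 1 := by simp [scal]

theorem scal_mul_inv (u : ℂˣ) : scal R u * scal R u⁻¹ = 1 := by
  rw [scal_mul, mul_inv_cancel, scal_one]

theorem scal_inv_mul (u : ℂˣ) : scal R u⁻¹ * scal R u = 1 := by
  rw [scal_mul, inv_mul_cancel, scal_one]

end Scalar

/-! ### The defining relations as equations between generators -/

section Relations

variable {R : Type u} [CommRing R] [Algebra ℂ R] (q : ℂˣ) (g : ℂˣ → ℂˣ) (δ : ℂˣ → R) (c : ℂ)

local notation "E(" c "," x ")" => mk q g δ c x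

theorem phi_mul_phiInv (z : ℂˣ) : E(c,.phi z) * E(c,.phiInv z) = 1 := (phi q g δ c z).val_inv

theorem phiInv_mul_phi (z : ℂˣ) : E(c,.phiInv z) * E(c,.phi z) = 1 := (phi q g δ c z).inv_val

theorem psi_mul_psiInv (z : ℂˣ) : E(c,.psi z) * E(c,.psiInv z) = 1 := (psi q g δ c z).val_inv

theorem psiInv_mul_psi (z : ℂˣ) : E(c,.psiInv z) * E(c,.psi z) = 1 := (psi q g δ c z).inv_val

theorem phi_mul_phi (z w : ℂˣ) :
    E(c,.phi z) * E(c,.phi w) = E(c,.phi w) * E(c,.phi z) := by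
  simpa [mk] using toU_rel q g δ c (Rel.phi_phi z w)

theorem psi_mul_psi (z w : ℂˣ) :
    E(c,.psi z) * E(c,.psi w) = E(c,.psi w) * E(c,.psi z) := by
  simpa [mk] using toU_rel q g δ c (Rel.psi_psi z w)

theorem phi_conj_phi (z w : ℂˣ) :
    E(c,.phi z) * E(c,.phi w) * E(c,.phiInv z) = E(c,.phi w) := by
  rw [phi_mul_phi, mul_assoc, phi_mul_phiInv, mul_one]

theorem psi_conj_psi (z w : ℂˣ) :
    E(c,.psi z) * E(c,.psi w) * E(c,.psiInv z) = E(c,.psi w) := by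
  rw [psi_mul_psi, mul_assoc, psi_mul_psiInv, mul_one]

theorem phi_psi_phiInv_psiInv (z w : ℂˣ) :
    E(c,.phi z) * E(c,.psi w) * E(c,.phiInv z) * E(c,.psiInv w) =
      algebraMap R _ (scal R (g (z / w * qPow q (-c)) / g (z / w * qPow q c))) := by
  simpa [mk, scal] using toU_rel q g δ c (Rel.phi_psi z w)

theorem phi_conj_psi (z w : ℂˣ) :
    E(c,.phi z) * E(c,.psi w) * E(c,.phiInv z) =
      scal R (g (z / w * qPow q (-c)) / g (z / w * qPow q c)) • E(c,.psi w) := by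
  rw [Algebra.smul_def, ← phi_psi_phiInv_psiInv, mul_assoc _ E(c,.psiInv w), psiInv_mul_psi,
    mul_one]

/-- The commutator of `φ(z)` and `ψ(w)` is a scalar, so exchanging their roles inverts it. -/
theorem psi_conj_phi (z w : ℂˣ) :
    E(c,.psi w) * E(c,.phi z) * E(c,.psiInv w) =
      scal R (g (z / w * qPow q c) / g (z / w * qPow q (-c))) • E(c,.phi z) := by
  rw [mul_eq_smul_mul_of_conj_inv (s := scal R (g (z / w * qPow q c) / g (z / w * qPow q (-c))))
    (phiInv_mul_phi q g δ c z) (by rw [scal_mul, div_mul_div_cancel, div_self', scal_one])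
    (phi_conj_psi q g δ c z w), smul_mul_assoc, mul_assoc, psi_mul_psiInv, mul_one]

theorem phi_conj_xPlus (z w : ℂˣ) :
    E(c,.phi z) * E(c,.xPlus w) * E(c,.phiInv z) =
      scal R (g (z / w * qPow q (-(c / 2)))) • E(c,.xPlus w) := by
  simpa only [mk, scal, map_mul, map_neg, map_smul] using toU_rel q g δ c (Rel.phi_xPlus z w)

theorem phi_conj_xMinus (z w : ℂˣ) :
    E(c,.phi z) * E(c,.xMinus w) * E(c,.phiInv z) =
      scal R (g (z / w * qPow q (c / 2)))⁻¹ • E(c,.xMinus w) := by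
  simpa only [mk, scal, map_mul, map_neg, map_smul] using toU_rel q g δ c (Rel.phi_xMinus z w)

theorem psi_conj_xPlus (z w : ℂˣ) :
    E(c,.psi z) * E(c,.xPlus w) * E(c,.psiInv z) =
      scal R (g (w / z * qPow q (-(c / 2))))⁻¹ • E(c,.xPlus w) := by
  simpa only [mk, scal, map_mul, map_neg, map_smul] using toU_rel q g δ c (Rel.psi_xPlus z w)

theorem psi_conj_xMinus (z w : ℂˣ) :
    E(c,.psi z) * E(c,.xMinus w) * E(c,.psiInv z) =
      scal R (g (w / z * qPow q (c / 2))) • E(c,.xMinus w) := by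
  simpa only [mk, scal, map_mul, map_neg, map_smul] using toU_rel q g δ c (Rel.psi_xMinus z w)

theorem xPlus_mul_xMinus_add (z w : ℂˣ) :
    E(c,.xPlus z) * E(c,.xMinus w) + E(c,.xMinus w) * E(c,.xPlus z) =
      algebraMap ℂ R (1 / ((q : ℂ) - (q : ℂ)⁻¹)) •
        (δ (z / w * qPow q (-c)) • E(c,.psi (w * qPow q (c / 2))) -
          δ (z / w * qPow q c) • E(c,.phi (z * qPow q (c / 2)))) := by
  simpa only [mk, map_add, map_mul, map_sub, map_smul] using
    toU_rel q g δ c (Rel.xPlus_xMinus z w)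

theorem xPlus_mul_xPlus (z w : ℂˣ) :
    E(c,.xPlus z) * E(c,.xPlus w) =
      -(scal R (g (z / w)) • (E(c,.xPlus w) * E(c,.xPlus z))) := by
  simpa only [mk, scal, map_mul, map_neg, map_smul] using toU_rel q g δ c (Rel.xPlus_xPlus z w)

theorem xMinus_mul_xMinus (z w : ℂˣ) :
    E(c,.xMinus z) * E(c,.xMinus w) =
      -(scal R (g (z / w))⁻¹ • (E(c,.xMinus w) * E(c,.xMinus z))) := by
  simpa only [mk, scal, map_mul, map_neg, map_smul] using toU_rel q g δ c (Rel.xMinus_xMinus z w)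

end Relations

/-! ### Homomorphisms out of the presented algebra -/

section Lift

variable {R : Type u} [CommRing R] [Algebra ℂ R] (q : ℂˣ) (g : ℂˣ → ℂˣ) (δ : ℂˣ → R) (c : ℂ)
  {B : Type u} [Ring B] [Algebra R B]

/-- The elements `f x` satisfy the defining relations of the generators at the value `c` of the
central element. -/
structure IsRealization (f : Gen → B) : Prop where
  phi_mul_phiInv : ∀ z, f (.phi z) * f (.phiInv z) = 1
  phiInv_mul_phi : ∀ z, f (.phiInv z) * f (.phi z) = 1
  psi_mul_psiInv : ∀ z, f (.psi z) * f (.psiInv z) = 1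
  psiInv_mul_psi : ∀ z, f (.psiInv z) * f (.psi z) = 1
  phi_phi : ∀ z w, f (.phi z) * f (.phi w) = f (.phi w) * f (.phi z)
  psi_psi : ∀ z w, f (.psi z) * f (.psi w) = f (.psi w) * f (.psi z)
  phi_psi : ∀ z w, f (.phi z) * f (.psi w) * f (.phiInv z) * f (.psiInv w) =
    algebraMap R _ (scal R (g (z / w * qPow q (-c)) / g (z / w * qPow q c)))
  phi_xPlus : ∀ z w, f (.phi z) * f (.xPlus w) * f (.phiInv z) =
    scal R (g (z / w * qPow q (-(c / 2)))) • f (.xPlus w)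
  phi_xMinus : ∀ z w, f (.phi z) * f (.xMinus w) * f (.phiInv z) =
    scal R (g (z / w * qPow q (c / 2)))⁻¹ • f (.xMinus w)
  psi_xPlus : ∀ z w, f (.psi z) * f (.xPlus w) * f (.psiInv z) =
    scal R (g (w / z * qPow q (-(c / 2))))⁻¹ • f (.xPlus w)
  psi_xMinus : ∀ z w, f (.psi z) * f (.xMinus w) * f (.psiInv z) =
    scal R (g (w / z * qPow q (c / 2))) • f (.xMinus w)
  xPlus_xMinus : ∀ z w, f (.xPlus z) * f (.xMinus w) + f (.xMinus w) * f (.xPlus z) =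
    algebraMap ℂ R (1 / ((q : ℂ) - (q : ℂ)⁻¹)) •
      (δ (z / w * qPow q (-c)) • f (.psi (w * qPow q (c / 2))) -
        δ (z / w * qPow q c) • f (.phi (z * qPow q (c / 2))))
  xPlus_xPlus : ∀ z w, f (.xPlus z) * f (.xPlus w) =
    -(scal R (g (z / w)) • (f (.xPlus w) * f (.xPlus z)))
  xMinus_xMinus : ∀ z w, f (.xMinus z) * f (.xMinus w) =
    -(scal R (g (z / w))⁻¹ • (f (.xMinus w) * f (.xMinus z)))

variable {q g δ c}

/-- The algebra homomorphism out of `U` determined by a realization of the relations. -/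
def IsRealization.lift {f : Gen → B} (hf : IsRealization q g δ c f) : U q g δ c →ₐ[R] B :=
  FunctionalSuperalgebra.lift q g δ c (FreeAlgebra.lift R f) (by
    rintro a b (_ | _ | _ | _ | _ | _ | _ | _ | _ | _ | _ | _ | _ | _) <;>
    simp only [map_mul, map_add, map_sub, map_neg, map_one, map_smul, AlgHom.commutes,
      FreeAlgebra.lift_ι_apply]
    · apply hf.phi_mul_phiInv
    · apply hf.phiInv_mul_phi
    · apply hf.psi_mul_psiInv
    · apply hf.psiInv_mul_psi
    · apply hf.phi_phi
    · apply hf.psi_psi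
    · apply hf.phi_psi
    · apply hf.phi_xPlus
    · apply hf.phi_xMinus
    · apply hf.psi_xPlus
    · apply hf.psi_xMinus
    · apply hf.xPlus_xMinus
    · apply hf.xPlus_xPlus
    · apply hf.xMinus_xMinus)

theorem IsRealization.lift_mk {f : Gen → B} (hf : IsRealization q g δ c f) (x : Gen) :
    hf.lift (FunctionalSuperalgebra.mk q g δ c x) = f x := by
  rw [IsRealization.lift, FunctionalSuperalgebra.mk, lift_toU, FreeAlgebra.lift_ι_apply]

end Lift

/-! ### Induction over the presented algebra -/

section Induction

variable {R : Type u} [CommRing R] [Algebra ℂ R] (q : ℂˣ) (g : ℂˣ → ℂˣ) (δ : ℂˣ → R) (c : ℂ)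

theorem U_induction {P : U q g δ c → Prop} (halg : ∀ r, P (algebraMap R _ r))
    (hgen : ∀ x, P (mk q g δ c x)) (hmul : ∀ a b, P a → P b → P (a * b))
    (hadd : ∀ a b, P a → P b → P (a + b)) (a : U q g δ c) : P a := by
  obtain ⟨a, rfl⟩ := toU_surjective q g δ c a
  induction a using FreeAlgebra.induction with
  | grade0 r => simpa using halg r
  | grade1 x => exact hgen x
  | mul a b ha hb => simpa using hmul _ _ ha hb
  | add a b ha hb => simpa using hadd _ _ ha hb

end Induction

/-! ### Multiplication in the graded tensor product, with signs expressed by parity -/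

section Tensor

open GradedTensorProduct (tmul)

variable {R : Type u} [CommRing R] [Algebra ℂ R] (q : ℂˣ) (g : ℂˣ → ℂˣ) (δ : ℂˣ → R) (c₁ c₂ : ℂ)

local notation "E(" c "," x ")" => mk q g δ c x

theorem mk_mem (c : ℂ) (x : Gen) (i : ZMod 2) (h : Gen.sign R x = ((-1 : ℤˣ) ^ i : ℤˣ)) :
    E(c,x) ∈ grading q g δ c i := by
  rw [mem_grading, parity_mk, h, Units.smul_def, Int.cast_smul_eq_zsmul]

variable {q g δ c₁ c₂}

theorem one_mem_grading {c : ℂ} : (1 : U q g δ c) ∈ grading q g δ c 0 := SetLike.one_mem_graded _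

theorem phiInv_mem {c : ℂ} (z : ℂˣ) : E(c,.phiInv z) ∈ grading q g δ c 0 :=
  mk_mem q g δ c _ 0 (by simp [Gen.sign])

theorem psiInv_mem {c : ℂ} (z : ℂˣ) : E(c,.psiInv z) ∈ grading q g δ c 0 :=
  mk_mem q g δ c _ 0 (by simp [Gen.sign])

theorem mk_phi_mem {c : ℂ} (z : ℂˣ) : E(c,.phi z) ∈ grading q g δ c 0 := phi_mem q g δ c z

theorem mk_psi_mem {c : ℂ} (z : ℂˣ) : E(c,.psi z) ∈ grading q g δ c 0 := psi_mem q g δ c z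

theorem mk_xPlus_mem {c : ℂ} (z : ℂˣ) : E(c,.xPlus z) ∈ grading q g δ c 1 := xPlus_mem q g δ c z

theorem mk_xMinus_mem {c : ℂ} (z : ℂˣ) : E(c,.xMinus z) ∈ grading q g δ c 1 := xMinus_mem q g δ c z

theorem parity_of_even {c : ℂ} {a : U q g δ c} (ha : a ∈ grading q g δ c 0) :
    parity q g δ c a = a := by
  simpa using (mem_grading q g δ c 0 a).1 ha

theorem parity_of_odd {c : ℂ} {a : U q g δ c} (ha : a ∈ grading q g δ c 1) :
    parity q g δ c a = -a := by
  simpa using (mem_grading q g δ c 1 a).1 ha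

theorem mem_even_iff {c : ℂ} {a : U q g δ c} :
    a ∈ grading q g δ c 0 ↔ parity q g δ c a = a := by
  simp [mem_grading]

theorem mem_odd_iff {c : ℂ} {a : U q g δ c} :
    a ∈ grading q g δ c 1 ↔ parity q g δ c a = -a := by
  simp [mem_grading]

/-- An element is a sum of an even and an odd one. -/
theorem exists_even_add_odd {c : ℂ} (a : U q g δ c) :
    ∃ a₀ ∈ grading q g δ c 0, ∃ a₁ ∈ grading q g δ c 1, a = a₀ + a₁ :=
  ⟨_, (proj q g δ c 0 a).2, _, (proj q g δ c 1 a).2, (proj_add_proj q g δ c a).symm⟩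

theorem tmul_add' (a : U q g δ c₁) (b b' : U q g δ c₂) :
    (tmul R a (b + b') : grading q g δ c₁ ᵍ⊗[R] grading q g δ c₂) = tmul R a b + tmul R a b' := by
  simp [tmul, TensorProduct.tmul_add]

theorem add_tmul' (a a' : U q g δ c₁) (b : U q g δ c₂) :
    (tmul R (a + a') b : grading q g δ c₁ ᵍ⊗[R] grading q g δ c₂) = tmul R a b + tmul R a' b := by
  simp [tmul, TensorProduct.add_tmul]

theorem smul_tmul' (r : R) (a : U q g δ c₁) (b : U q g δ c₂) :
    (tmul R (r • a) b : grading q g δ c₁ ᵍ⊗[R] grading q g δ c₂) = r • tmul R a b := by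
  simp [tmul, ← TensorProduct.smul_tmul']

theorem tmul_smul' (r : R) (a : U q g δ c₁) (b : U q g δ c₂) :
    (tmul R a (r • b) : grading q g δ c₁ ᵍ⊗[R] grading q g δ c₂) = r • tmul R a b := by
  simp [tmul, TensorProduct.tmul_smul]

theorem neg_tmul' (a : U q g δ c₁) (b : U q g δ c₂) :
    (tmul R (-a) b : grading q g δ c₁ ᵍ⊗[R] grading q g δ c₂) = -tmul R a b := by
  simp [tmul, TensorProduct.neg_tmul]

theorem tmul_neg' (a : U q g δ c₁) (b : U q g δ c₂) :
    (tmul R a (-b) : grading q g δ c₁ ᵍ⊗[R] grading q g δ c₂) = -tmul R a b := by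
  simp [tmul, TensorProduct.tmul_neg]

theorem tmul_mul_tmul_of_even {b : U q g δ c₂} (hb : b ∈ grading q g δ c₂ 0)
    (a a' : U q g δ c₁) (b' : U q g δ c₂) :
    (tmul R a b * tmul R a' b' : grading q g δ c₁ ᵍ⊗[R] grading q g δ c₂) =
      tmul R (a * a') (b * b') := by
  obtain ⟨a₀, h₀, a₁, h₁, rfl⟩ := exists_even_add_odd a'
  rw [add_tmul', mul_add, mul_add, add_tmul']
  exact congrArg₂ (· + ·)
    (GradedTensorProduct.tmul_zero_coe_mul_coe_tmul _ _ a ⟨b, hb⟩ ⟨a₀, h₀⟩ b')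
    (GradedTensorProduct.tmul_zero_coe_mul_coe_tmul _ _ a ⟨b, hb⟩ ⟨a₁, h₁⟩ b')

/-- Moving an odd `b` past `a'` costs the sign `(-1) ^ deg a'` on homogeneous parts, which is what
the parity automorphism does to all of `a'` at once. -/
theorem tmul_mul_tmul_of_odd {b : U q g δ c₂} (hb : b ∈ grading q g δ c₂ 1)
    (a a' : U q g δ c₁) (b' : U q g δ c₂) :
    (tmul R a b * tmul R a' b' : grading q g δ c₁ ᵍ⊗[R] grading q g δ c₂) =
      tmul R (a * parity q g δ c₁ a') (b * b') := by
  obtain ⟨a₀, h₀, a₁, h₁, rfl⟩ := exists_even_add_odd a'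
  rw [add_tmul', mul_add, map_add, mul_add, add_tmul', parity_of_even h₀, parity_of_odd h₁]
  have e₀ := GradedTensorProduct.tmul_coe_mul_zero_coe_tmul (grading q g δ c₁) _ a ⟨b, hb⟩
    ⟨a₀, h₀⟩ b'
  have e₁ := GradedTensorProduct.tmul_coe_mul_coe_tmul (grading q g δ c₁) _ a ⟨b, hb⟩
    ⟨a₁, h₁⟩ b'
  rw [mul_one, uzpow_one, Units.neg_smul, one_smul] at e₁
  rw [mul_neg, neg_tmul']
  exact congrArg₂ (· + ·) e₀ e₁

/-- The sign depends only on the product of the degrees of the two inner factors, so it is also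
trivial when the right one of them is even. This version serves multiplication from the right. -/
theorem tmul_mul_tmul_of_even_left {a' : U q g δ c₁} (ha : a' ∈ grading q g δ c₁ 0)
    (a : U q g δ c₁) (b b' : U q g δ c₂) :
    (tmul R a b * tmul R a' b' : grading q g δ c₁ ᵍ⊗[R] grading q g δ c₂) =
      tmul R (a * a') (b * b') := by
  obtain ⟨b₀, h₀, b₁, h₁, rfl⟩ := exists_even_add_odd b
  rw [tmul_add', add_mul, tmul_mul_tmul_of_even h₀, tmul_mul_tmul_of_odd h₁, parity_of_even ha,
    add_mul, tmul_add']

theorem tmul_mul_tmul_of_odd_left {a' : U q g δ c₁} (ha : a' ∈ grading q g δ c₁ 1)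
    (a : U q g δ c₁) (b b' : U q g δ c₂) :
    (tmul R a b * tmul R a' b' : grading q g δ c₁ ᵍ⊗[R] grading q g δ c₂) =
      tmul R (a * a') (parity q g δ c₂ b * b') := by
  obtain ⟨b₀, h₀, b₁, h₁, rfl⟩ := exists_even_add_odd b
  rw [tmul_add', add_mul, tmul_mul_tmul_of_even h₀, tmul_mul_tmul_of_odd h₁, parity_of_odd ha,
    map_add, parity_of_even h₀, parity_of_odd h₁, add_mul, tmul_add', mul_neg, neg_mul, neg_tmul',
    tmul_neg']

theorem one_tmul_one : (tmul R 1 1 : grading q g δ c₁ ᵍ⊗[R] grading q g δ c₂) = 1 := rfl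

end Tensor

/-! ### The coproduct -/

section Comul

open GradedTensorProduct (tmul)

variable {R : Type u} [CommRing R] [Algebra ℂ R] (q : ℂˣ) (g : ℂˣ → ℂˣ) (δ : ℂˣ → R) (c₁ c₂ : ℂ)

local notation "E(" c "," x ")" => mk q g δ c x

/-- The coproduct on the generators. -/
noncomputable def comulGen : Gen → grading q g δ c₁ ᵍ⊗[R] grading q g δ c₂
  | .xPlus z => tmul R E(c₁,.xPlus z) 1 +
      tmul R E(c₁,.phi (z * qPow q (c₁ / 2))) E(c₂,.xPlus (z * qPow q c₁))
  | .xMinus z => tmul R 1 E(c₂,.xMinus z) +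
      tmul R E(c₁,.xMinus (z * qPow q c₂)) E(c₂,.psi (z * qPow q (c₂ / 2)))
  | .phi z => tmul R E(c₁,.phi (z * qPow q (-(c₂ / 2)))) E(c₂,.phi (z * qPow q (c₁ / 2)))
  | .phiInv z => tmul R E(c₁,.phiInv (z * qPow q (-(c₂ / 2)))) E(c₂,.phiInv (z * qPow q (c₁ / 2)))
  | .psi z => tmul R E(c₁,.psi (z * qPow q (c₂ / 2))) E(c₂,.psi (z * qPow q (-(c₁ / 2))))
  | .psiInv z => tmul R E(c₁,.psiInv (z * qPow q (c₂ / 2))) E(c₂,.psiInv (z * qPow q (-(c₁ / 2))))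

variable {g}

/-- Images of `φ` and `ψ` are even pure tensors, so conjugation by them acts on each leg separately
and the relations involving them reduce to identities between scalars. The three relations between
the odd generators are expanded into four products each. -/
theorem comulGen_isRealization (hg : ∀ z, g z = (g z⁻¹)⁻¹) {c : ℂ} (hc : c = c₁ + c₂) :
    IsRealization q g δ c (comulGen q g δ c₁ c₂) := by
  subst hc
  have phi_conj : ∀ (z a b), comulGen q g δ c₁ c₂ (.phi z) * tmul R a b *
      comulGen q g δ c₁ c₂ (.phiInv z) =
      tmul R (E(c₁,.phi (z * qPow q (-(c₂ / 2)))) * a * E(c₁,.phiInv (z * qPow q (-(c₂ / 2)))))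
        (E(c₂,.phi (z * qPow q (c₁ / 2))) * b * E(c₂,.phiInv (z * qPow q (c₁ / 2)))) := by
    intro z a b
    rw [comulGen, comulGen, tmul_mul_tmul_of_even (mk_phi_mem _),
      tmul_mul_tmul_of_even_left (phiInv_mem _)]
  have psi_conj : ∀ (z a b), comulGen q g δ c₁ c₂ (.psi z) * tmul R a b *
      comulGen q g δ c₁ c₂ (.psiInv z) =
      tmul R (E(c₁,.psi (z * qPow q (c₂ / 2))) * a * E(c₁,.psiInv (z * qPow q (c₂ / 2))))
        (E(c₂,.psi (z * qPow q (-(c₁ / 2)))) * b * E(c₂,.psiInv (z * qPow q (-(c₁ / 2))))) := by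
    intro z a b
    rw [comulGen, comulGen, tmul_mul_tmul_of_even (mk_psi_mem _),
      tmul_mul_tmul_of_even_left (psiInv_mem _)]
  have inv_mul_div : ∀ a b : ℂˣ, a⁻¹ * (a / b) = b⁻¹ := fun a b => by
    rw [div_eq_mul_inv, inv_mul_cancel_left]
  have div_mul_inv : ∀ a b : ℂˣ, a / b * a⁻¹ = b⁻¹ := fun a b => by rw [mul_comm, inv_mul_div]
  constructor
  · intro z
    rw [comulGen, comulGen, tmul_mul_tmul_of_even (mk_phi_mem _), phi_mul_phiInv, phi_mul_phiInv,
      one_tmul_one]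
  · intro z
    rw [comulGen, comulGen, tmul_mul_tmul_of_even (phiInv_mem _), phiInv_mul_phi, phiInv_mul_phi,
      one_tmul_one]
  · intro z
    rw [comulGen, comulGen, tmul_mul_tmul_of_even (mk_psi_mem _), psi_mul_psiInv, psi_mul_psiInv,
      one_tmul_one]
  · intro z
    rw [comulGen, comulGen, tmul_mul_tmul_of_even (psiInv_mem _), psiInv_mul_psi, psiInv_mul_psi,
      one_tmul_one]
  · intro z w
    rw [comulGen, comulGen, tmul_mul_tmul_of_even (mk_phi_mem _),
      tmul_mul_tmul_of_even (mk_phi_mem _),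
      phi_mul_phi, phi_mul_phi q g δ c₂]
  · intro z w
    rw [comulGen, comulGen, tmul_mul_tmul_of_even (mk_psi_mem _),
      tmul_mul_tmul_of_even (mk_psi_mem _),
      psi_mul_psi, psi_mul_psi q g δ c₂]
  · intro z w
    rw [comulGen.eq_5, phi_conj, comulGen, tmul_mul_tmul_of_even_left (psiInv_mem _),
      phi_psi_phiInv_psiInv, phi_psi_phiInv_psiInv, Algebra.algebraMap_eq_smul_one,
      Algebra.algebraMap_eq_smul_one, Algebra.algebraMap_eq_smul_one, smul_tmul', tmul_smul',
      smul_smul, scal_mul, one_tmul_one]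
    -- The legs contribute `g(z/w q^(-c₁-c₂)) / g(z/w q^(c₁-c₂))` and `g(z/w q^(c₁-c₂)) / g(z/w
    -- q^(c₁+c₂))`; the middle value cancels once the exponents are normalised.
    simp only [mul_qPow_div, div_mul_qPow, mul_qPow_mul_qPow]
    ring_nf
    rw [div_mul_div_cancel]
  · intro z w
    rw [comulGen.eq_1, mul_add, add_mul, phi_conj, phi_conj, smul_add, mul_one, phi_mul_phiInv,
      phi_conj_phi, phi_conj_xPlus, phi_conj_xPlus, smul_tmul', tmul_smul']
    simp only [mul_qPow_div, div_mul_qPow, mul_qPow_mul_qPow]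
    ring_nf
  · intro z w
    rw [comulGen.eq_2, mul_add, add_mul, phi_conj, phi_conj, smul_add, mul_one, phi_mul_phiInv,
      phi_conj_psi, phi_conj_xMinus, phi_conj_xMinus, smul_tmul', tmul_smul', tmul_smul', smul_smul,
      scal_mul]
    simp only [mul_qPow_div, div_mul_qPow, mul_qPow_mul_qPow]
    ring_nf
    rw [inv_mul_div]
  · intro z w
    rw [comulGen.eq_1, mul_add, add_mul, psi_conj, psi_conj, smul_add, mul_one, psi_mul_psiInv,
      psi_conj_phi, psi_conj_xPlus, psi_conj_xPlus, smul_tmul', smul_tmul', tmul_smul', smul_smul,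
      scal_mul]
    simp only [mul_qPow_div, div_mul_qPow, mul_qPow_mul_qPow]
    ring_nf
    rw [div_mul_inv]
  · intro z w
    rw [comulGen.eq_2, mul_add, add_mul, psi_conj, psi_conj, smul_add, mul_one, psi_mul_psiInv,
      psi_conj_psi, psi_conj_xMinus, psi_conj_xMinus, smul_tmul', tmul_smul']
    simp only [mul_qPow_div, div_mul_qPow, mul_qPow_mul_qPow]
    ring_nf
  · intro z w
    have h₁ := xPlus_mul_xMinus_add q g δ c₁ z (w * qPow q c₂)
    have h₂ := xPlus_mul_xMinus_add q g δ c₂ (z * qPow q c₁) w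
    -- `h₃` and `h₄` reorder the cross terms of `φ ⊗ x⁺` with `x⁻ ⊗ ψ`. Their scalars are the
    -- inverse of `g(z/w q^(c₁-c₂))` and that value itself, so these terms anticommute exactly.
    have h₃ := mul_eq_smul_mul_of_conj (phiInv_mul_phi q g δ c₁ _)
      (phi_conj_xMinus q g δ c₁ (z * qPow q (c₁ / 2)) (w * qPow q c₂))
    have h₄ := mul_eq_smul_mul_of_conj_inv (psiInv_mul_psi q g δ c₂ _) (scal_mul_inv R _)
      (psi_conj_xPlus q g δ c₂ (w * qPow q (c₂ / 2)) (z * qPow q c₁))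
    simp only [mul_qPow_div, div_mul_qPow, mul_qPow_mul_qPow] at h₁ h₂ h₃ h₄
    rw [show c₁ / 2 + -c₂ + c₁ / 2 = c₁ - c₂ by ring] at h₃
    rw [show c₁ + -(c₂ / 2) + -(c₂ / 2) = c₁ - c₂ by ring] at h₄
    rw [show -c₂ + -c₁ = -(c₁ + c₂) by ring, show -c₂ + c₁ = c₁ - c₂ by ring] at h₁
    rw [← sub_eq_add_neg] at h₂
    generalize algebraMap ℂ R (1 / ((q : ℂ) - (q : ℂ)⁻¹)) = k at h₁ h₂ ⊢
    have e₁ : w * qPow q ((c₁ + c₂) / 2) * qPow q (c₂ / 2) = w * qPow q (c₂ + c₁ / 2) := by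
      rw [mul_qPow_mul_qPow]; congr 2; ring
    have e₂ : w * qPow q ((c₁ + c₂) / 2) * qPow q (-(c₁ / 2)) = w * qPow q (c₂ / 2) := by
      rw [mul_qPow_mul_qPow]; congr 2; ring
    have e₃ : z * qPow q ((c₁ + c₂) / 2) * qPow q (-(c₂ / 2)) = z * qPow q (c₁ / 2) := by
      rw [mul_qPow_mul_qPow]; congr 2; ring
    have e₄ : z * qPow q ((c₁ + c₂) / 2) * qPow q (c₁ / 2) = z * qPow q (c₁ + c₂ / 2) := by
      rw [mul_qPow_mul_qPow]; congr 2; ring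
    -- What survives is the anticommutator in leg one tensored with `ψ`, plus `φ` tensored with the
    -- anticommutator in leg two. Both contain `δ(z/w q^(c₁-c₂)) φ(z q^(c₁/2)) ⊗ ψ(w q^(c₂/2))`,
    -- with opposite signs.
    simp only [comulGen, e₁, e₂, e₃, e₄, mul_add, add_mul, tmul_mul_tmul_of_even one_mem_grading,
      tmul_mul_tmul_of_even (mk_psi_mem _), tmul_mul_tmul_of_odd (mk_xPlus_mem _),
      tmul_mul_tmul_of_odd (mk_xMinus_mem _), parity_of_even (mk_phi_mem _),
      parity_of_odd (mk_xPlus_mem _),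
      parity_of_odd (mk_xMinus_mem _), map_one, mul_one, one_mul, mul_neg, neg_tmul',
      eq_sub_of_add_eq h₁, eq_sub_of_add_eq h₂, h₃, h₄, smul_tmul', tmul_smul', smul_smul,
      scal_mul_inv, one_smul, sub_eq_add_neg, add_tmul', tmul_add', tmul_neg', smul_add, smul_neg]
    abel
  · intro z w
    have h₁ : E(c₁,.phi (z * qPow q (c₁ / 2))) * E(c₁,.xPlus w) =
        scal R (g (z / w)) • (E(c₁,.xPlus w) * E(c₁,.phi (z * qPow q (c₁ / 2)))) := by
      have h := mul_eq_smul_mul_of_conj (phiInv_mul_phi q g δ c₁ _)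
        (phi_conj_xPlus q g δ c₁ (z * qPow q (c₁ / 2)) w)
      rwa [mul_qPow_div, mul_qPow_mul_qPow, add_neg_cancel, qPow_zero, mul_one] at h
    have h₂ : E(c₁,.xPlus z) * E(c₁,.phi (w * qPow q (c₁ / 2))) =
        scal R (g (z / w)) • (E(c₁,.phi (w * qPow q (c₁ / 2))) * E(c₁,.xPlus z)) := by
      refine mul_eq_smul_mul_of_conj_inv (phiInv_mul_phi q g δ c₁ _) ?_
        (phi_conj_xPlus q g δ c₁ (w * qPow q (c₁ / 2)) z)
      -- Conjugation yields `g(w/z)`; the symmetry of `g` turns its inverse into `g(z/w)`, the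
      -- scalar needed to match the other cross term.
      rw [mul_qPow_div, mul_qPow_mul_qPow, mul_qPow_eq_self _ _ (by ring), hg, inv_div,
        scal_inv_mul]
    have h₃ := xPlus_mul_xPlus q g δ c₁ z w
    have h₄ := xPlus_mul_xPlus q g δ c₂ (z * qPow q c₁) (w * qPow q c₁)
    rw [mul_div_mul_right_eq_div] at h₄
    rw [comulGen, comulGen]
    simp only [mul_add, add_mul, tmul_mul_tmul_of_even one_mem_grading,
      tmul_mul_tmul_of_odd (mk_xPlus_mem _), parity_of_even (mk_phi_mem _),
      parity_of_odd (mk_xPlus_mem _),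
      mul_one, one_mul, mul_neg, neg_tmul', h₁, h₂, h₃, h₄, phi_mul_phi q g δ c₁ (z * _) (w * _),
      smul_tmul', tmul_smul', tmul_neg']
    module
  · intro z w
    have h₁ : E(c₂,.psi (z * qPow q (c₂ / 2))) * E(c₂,.xMinus w) =
        scal R (g (z / w))⁻¹ • (E(c₂,.xMinus w) * E(c₂,.psi (z * qPow q (c₂ / 2)))) := by
      have h := mul_eq_smul_mul_of_conj (psiInv_mul_psi q g δ c₂ _)
        (psi_conj_xMinus q g δ c₂ (z * qPow q (c₂ / 2)) w)
      rwa [div_mul_qPow, mul_qPow_mul_qPow, neg_add_cancel, qPow_zero, mul_one, hg, inv_div] at h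
    have h₂ : E(c₂,.xMinus z) * E(c₂,.psi (w * qPow q (c₂ / 2))) =
        scal R (g (z / w))⁻¹ • (E(c₂,.psi (w * qPow q (c₂ / 2))) * E(c₂,.xMinus z)) := by
      refine mul_eq_smul_mul_of_conj_inv (psiInv_mul_psi q g δ c₂ _) ?_
        (psi_conj_xMinus q g δ c₂ (w * qPow q (c₂ / 2)) z)
      rw [div_mul_qPow, mul_qPow_mul_qPow, mul_qPow_eq_self _ _ (by ring), scal_inv_mul]
    have h₃ := xMinus_mul_xMinus q g δ c₂ z w
    have h₄ := xMinus_mul_xMinus q g δ c₁ (z * qPow q c₂) (w * qPow q c₂)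
    rw [mul_div_mul_right_eq_div] at h₄
    rw [comulGen, comulGen]
    simp only [mul_add, add_mul, tmul_mul_tmul_of_even (mk_psi_mem _),
      tmul_mul_tmul_of_odd (mk_xMinus_mem _), parity_of_odd (mk_xMinus_mem _), map_one,
      mul_one, one_mul, mul_neg, neg_tmul', h₁, h₂, h₃, h₄, psi_mul_psi q g δ c₂ (z * _) (w * _),
      smul_tmul', tmul_smul', tmul_neg']
    module

/-- The coproduct `U_{c₁ + c₂} → U_{c₁} ⊗ U_{c₂}`. -/
noncomputable def comul (hg : ∀ z, g z = (g z⁻¹)⁻¹) {c : ℂ} (hc : c = c₁ + c₂) :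
    U q g δ c →ₐ[R] grading q g δ c₁ ᵍ⊗[R] grading q g δ c₂ :=
  (comulGen_isRealization q δ c₁ c₂ hg hc).lift

theorem comul_mk (hg : ∀ z, g z = (g z⁻¹)⁻¹) {c : ℂ} (hc : c = c₁ + c₂) (x : Gen) :
    comul q δ c₁ c₂ hg hc (mk q g δ c x) = comulGen q g δ c₁ c₂ x :=
  IsRealization.lift_mk _ x

end Comul

/-! ### Evenness of the coproduct -/

section Parity

open GradedTensorProduct (tmul)

variable {R : Type u} [CommRing R] [Algebra ℂ R] (q : ℂˣ) (g : ℂˣ → ℂˣ) (δ : ℂˣ → R) (c₁ c₂ : ℂ)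

/-- The tensor product of the parity automorphisms. -/
noncomputable def tensorParity :
    grading q g δ c₁ ᵍ⊗[R] grading q g δ c₂ →ₗ[R] grading q g δ c₁ ᵍ⊗[R] grading q g δ c₂ :=
  (GradedTensorProduct.of R (grading q g δ c₁) (grading q g δ c₂)).toLinearMap ∘ₗ
    TensorProduct.map (parity q g δ c₁).toLinearMap (parity q g δ c₂).toLinearMap ∘ₗ
    (GradedTensorProduct.of R (grading q g δ c₁) (grading q g δ c₂)).symm.toLinearMap

theorem tensorParity_tmul (a : U q g δ c₁) (b : U q g δ c₂) :
    tensorParity q g δ c₁ c₂ (tmul R a b) = tmul R (parity q g δ c₁ a) (parity q g δ c₂ b) := rfl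

variable {q g δ c₁ c₂} in
@[elab_as_elim]
theorem tensor_induction {P : grading q g δ c₁ ᵍ⊗[R] grading q g δ c₂ → Prop}
    (htmul : ∀ a b, P (tmul R a b)) (hadd : ∀ s t, P s → P t → P (s + t))
    (t : grading q g δ c₁ ᵍ⊗[R] grading q g δ c₂) : P t := by
  have h : ∀ t : U q g δ c₁ ⊗[R] U q g δ c₂, P (GradedTensorProduct.of R _ _ t) := by
    intro t
    induction t using TensorProduct.induction_on with
    -- Zero is the pure tensor `0 ⊗ 0`, so the principle needs no separate case for it.
    | zero => simpa [tmul] using htmul 0 0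
    | tmul a b => exact htmul a b
    | add s t hs ht => rw [map_add]; exact hadd _ _ hs ht
  exact h ((GradedTensorProduct.of R _ _).symm t)

theorem tensorParity_mul (s t : grading q g δ c₁ ᵍ⊗[R] grading q g δ c₂) :
    tensorParity q g δ c₁ c₂ (s * t) =
      tensorParity q g δ c₁ c₂ s * tensorParity q g δ c₁ c₂ t := by
  induction s using tensor_induction with
  | hadd s s' hs hs' => rw [add_mul, map_add, map_add, add_mul, hs, hs']
  | htmul a b =>
    induction t using tensor_induction with
    | hadd t t' ht ht' => rw [mul_add, map_add, map_add, mul_add, ht, ht']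
    | htmul a' b' =>
      obtain ⟨b₀, h₀, b₁, h₁, rfl⟩ := exists_even_add_odd b
      simp only [tmul_add', add_mul, map_add, tmul_mul_tmul_of_even h₀, tmul_mul_tmul_of_odd h₁,
        tensorParity_tmul, parity_of_even h₀, parity_of_odd h₁, map_mul, tmul_neg', neg_mul]

/-- Both sides are multiplicative in `a`, the left one by `tensorParity_mul`, so generators suffice.
Besides giving evenness of the coproduct, this lets `σ` pass through `Δ` in the proof of
coassociativity. -/
theorem tensorParity_comul (hg : ∀ z, g z = (g z⁻¹)⁻¹) {c : ℂ} (hc : c = c₁ + c₂) (a : U q g δ c) :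
    tensorParity q g δ c₁ c₂ (comul q δ c₁ c₂ hg hc a) =
      comul q δ c₁ c₂ hg hc (parity q g δ c a) := by
  induction a using U_induction with
  | halg r =>
    rw [AlgHom.commutes, AlgHom.commutes, AlgHom.commutes, Algebra.algebraMap_eq_smul_one, map_smul,
      ← one_tmul_one, tensorParity_tmul, map_one, map_one]
  | hgen x =>
    rw [parity_mk, map_smul, comul_mk]
    cases x <;> simp [comulGen, tensorParity_tmul, parity_mk, Gen.sign, neg_tmul', tmul_neg']
  | hmul a b ha hb => rw [map_mul, tensorParity_mul, ha, hb, map_mul, map_mul]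
  | hadd a b ha hb => rw [map_add, map_add, ha, hb, map_add, map_add]

/-- Up to the factor one half this is the projection onto total degree `i`: it doubles a homogeneous
tensor of that degree and kills one of the other degree. -/
theorem tensor_add_parity_mem (i : ZMod 2) (t : grading q g δ c₁ ᵍ⊗[R] grading q g δ c₂) :
    t + ((-1 : ℤˣ) ^ i) • tensorParity q g δ c₁ c₂ t ∈
      tensorDegree (grading q g δ c₁) (grading q g δ c₂) i := by
  induction t using tensor_induction with
  | hadd s t hs ht =>
    rw [map_add, smul_add, add_add_add_comm]
    exact add_mem hs ht
  | htmul a b =>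
    have key : ∀ (j k : ZMod 2) (a : U q g δ c₁) (b : U q g δ c₂), a ∈ grading q g δ c₁ j →
        b ∈ grading q g δ c₂ k →
        (tmul R a b + ((-1 : ℤˣ) ^ i) • tensorParity q g δ c₁ c₂ (tmul R a b) :
          grading q g δ c₁ ᵍ⊗[R] grading q g δ c₂) ∈
        tensorDegree (grading q g δ c₁) (grading q g δ c₂) i := by
      intro j k a b ha hb
      by_cases h : j + k = i
      · have hm : (tmul R a b : grading q g δ c₁ ᵍ⊗[R] grading q g δ c₂) ∈
            tensorDegree (grading q g δ c₁) (grading q g δ c₂) i :=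
          Submodule.subset_span ⟨j, k, a, b, h, ha, hb, rfl⟩
        have hm' : tensorParity q g δ c₁ c₂ (tmul R a b) ∈
            tensorDegree (grading q g δ c₁) (grading q g δ c₂) i :=
          Submodule.subset_span ⟨j, k, parity q g δ c₁ a, parity q g δ c₂ b, h, by
            rw [(mem_grading _ _ _ _ _ _).1 ha]; exact zsmul_mem ha _, by
            rw [(mem_grading _ _ _ _ _ _).1 hb]; exact zsmul_mem hb _, rfl⟩
        exact add_mem hm (zsmul_mem hm' _)
      · have hz : ∀ i : ZMod 2, i = 0 ∨ i = 1 := by decide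
        convert zero_mem (tensorDegree (grading q g δ c₁) (grading q g δ c₂) i)
        rw [tensorParity_tmul]
        obtain rfl | rfl := hz i <;> obtain rfl | rfl := hz j <;> obtain rfl | rfl := hz k <;>
        first
        | exact absurd (by decide) h
        | simp [parity_of_even, parity_of_odd, ha, hb, neg_tmul', tmul_neg']
    obtain ⟨a₀, ha₀, a₁, ha₁, rfl⟩ := exists_even_add_odd a
    obtain ⟨b₀, hb₀, b₁, hb₁, rfl⟩ := exists_even_add_odd b
    convert add_mem (add_mem (key 0 0 a₀ b₀ ha₀ hb₀) (key 0 1 a₀ b₁ ha₀ hb₁))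
      (add_mem (key 1 0 a₁ b₀ ha₁ hb₀) (key 1 1 a₁ b₁ ha₁ hb₁)) using 1
    simp only [add_tmul', tmul_add', map_add, smul_add]
    abel

/-- For `a` of degree `i`, compatibility with parity makes `Δ(a)` equal to its own projection onto
degree `i`, and the image of that projection lies in the span defining `tensorDegree`. -/
theorem comul_mem (hg : ∀ z, g z = (g z⁻¹)⁻¹) {c : ℂ} (hc : c = c₁ + c₂) (i : ZMod 2)
    {a : U q g δ c} (ha : a ∈ grading q g δ c i) :
    comul q δ c₁ c₂ hg hc a ∈ tensorDegree (grading q g δ c₁) (grading q g δ c₂) i := by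
  have h := Submodule.smul_mem _ (half : R)
    (tensor_add_parity_mem q g δ c₁ c₂ i (comul q δ c₁ c₂ hg hc a))
  rwa [tensorParity_comul, (mem_grading _ _ _ _ _ _).1 ha, AlgHom.map_smul_of_tower, smul_smul,
    Int.units_mul_self, one_smul, smul_add, ← add_smul, half_add_half, one_smul] at h

end Parity

/-! ### Coassociativity -/

section Coassoc

open GradedTensorProduct (tmul)

variable {R : Type u} [CommRing R] [Algebra ℂ R] (q : ℂˣ) {g : ℂˣ → ℂˣ} (δ : ℂˣ → R)
  (hg : ∀ z, g z = (g z⁻¹)⁻¹) {c c₁ c₂ c₃ c₁₂ c₂₃ : ℂ}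

local notation "E(" c "," x ")" => mk q g δ c x

/-- `Δ ⊗ id` on the graded tensor product. -/
noncomputable def comulLeft (h₁₂ : c₁₂ = c₁ + c₂) (c₃ : ℂ) :
    grading q g δ c₁₂ ᵍ⊗[R] grading q g δ c₃ →ₗ[R] U q g δ c₁ ⊗[R] (U q g δ c₂ ⊗[R] U q g δ c₃) :=
  (TensorProduct.assoc R (U q g δ c₁) (U q g δ c₂) (U q g δ c₃)).toLinearMap ∘ₗ
    TensorProduct.map
      ((GradedTensorProduct.of R (grading q g δ c₁) (grading q g δ c₂)).symm.toLinearMap ∘ₗ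
        (comul q δ c₁ c₂ hg h₁₂).toLinearMap) LinearMap.id ∘ₗ
    (GradedTensorProduct.of R (grading q g δ c₁₂) (grading q g δ c₃)).symm.toLinearMap

/-- `id ⊗ Δ` on the graded tensor product. -/
noncomputable def comulRight (h₂₃ : c₂₃ = c₂ + c₃) (c₁ : ℂ) :
    grading q g δ c₁ ᵍ⊗[R] grading q g δ c₂₃ →ₗ[R] U q g δ c₁ ⊗[R] (U q g δ c₂ ⊗[R] U q g δ c₃) :=
  TensorProduct.map LinearMap.id
      ((GradedTensorProduct.of R (grading q g δ c₂) (grading q g δ c₃)).symm.toLinearMap ∘ₗ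
        (comul q δ c₂ c₃ hg h₂₃).toLinearMap) ∘ₗ
    (GradedTensorProduct.of R (grading q g δ c₁) (grading q g δ c₂₃)).symm.toLinearMap

/-- The reassociation of `t ⊗ b`. -/
noncomputable def tensorLeft (t : grading q g δ c₁ ᵍ⊗[R] grading q g δ c₂) (b : U q g δ c₃) :
    U q g δ c₁ ⊗[R] (U q g δ c₂ ⊗[R] U q g δ c₃) :=
  TensorProduct.assoc R _ _ _ ((GradedTensorProduct.of R _ _).symm t ⊗ₜ b)

/-- `a ⊗ t` in the plain tensor product. -/
noncomputable def tensorRight (a : U q g δ c₁) (t : grading q g δ c₂ ᵍ⊗[R] grading q g δ c₃) :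
    U q g δ c₁ ⊗[R] (U q g δ c₂ ⊗[R] U q g δ c₃) :=
  a ⊗ₜ (GradedTensorProduct.of R _ _).symm t

theorem comulLeft_tmul (h₁₂ : c₁₂ = c₁ + c₂) (a : U q g δ c₁₂) (b : U q g δ c₃) :
    comulLeft q δ hg h₁₂ c₃ (tmul R a b) = tensorLeft q δ (comul q δ c₁ c₂ hg h₁₂ a) b := rfl

theorem comulRight_tmul (h₂₃ : c₂₃ = c₂ + c₃) (a : U q g δ c₁) (b : U q g δ c₂₃) :
    comulRight q δ hg h₂₃ c₁ (tmul R a b) = tensorRight q δ a (comul q δ c₂ c₃ hg h₂₃ b) := rfl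

theorem tensorLeft_tmul (a : U q g δ c₁) (b : U q g δ c₂) (d : U q g δ c₃) :
    tensorLeft q δ (tmul R a b) d = a ⊗ₜ (b ⊗ₜ d) := rfl

theorem tensorRight_tmul (a : U q g δ c₁) (b : U q g δ c₂) (d : U q g δ c₃) :
    tensorRight q δ a (tmul R b d) = a ⊗ₜ (b ⊗ₜ d) := rfl

theorem tensorLeft_add (s t : grading q g δ c₁ ᵍ⊗[R] grading q g δ c₂) (b : U q g δ c₃) :
    tensorLeft q δ (s + t) b = tensorLeft q δ s b + tensorLeft q δ t b := by
  simp [tensorLeft, TensorProduct.add_tmul]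

theorem tensorRight_add (a : U q g δ c₁) (s t : grading q g δ c₂ ᵍ⊗[R] grading q g δ c₃) :
    tensorRight q δ a (s + t) = tensorRight q δ a s + tensorRight q δ a t := by
  simp [tensorRight, TensorProduct.tmul_add]

local notation "ℓ" => LinearMap.mulLeft R
local notation "σ" c => AlgHom.toLinearMap (parity q g δ c)

/-- The operator `Λ` plays the role of left multiplication by the iterated coproduct of `x` on the
triple tensor product. Writing it as an explicit endomorphism, with `σ` for the signs, avoids
putting a graded multiplication on three factors. -/
theorem exists_left_mul_comulGen (h₁₂ : c₁₂ = c₁ + c₂) (h₂₃ : c₂₃ = c₂ + c₃) (x : Gen) :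
    ∃ Λ : Module.End R (U q g δ c₁ ⊗[R] (U q g δ c₂ ⊗[R] U q g δ c₃)),
      (∀ u, comulLeft q δ hg h₁₂ c₃ (comulGen q g δ c₁₂ c₃ x * u) =
        Λ (comulLeft q δ hg h₁₂ c₃ u)) ∧
      ∀ u, comulRight q δ hg h₂₃ c₁ (comulGen q g δ c₁ c₂₃ x * u) =
        Λ (comulRight q δ hg h₂₃ c₁ u) := by
  -- It suffices to treat pure tensors `a ⊗ b`. The coproduct of the factor that gets expanded is
  -- named `t`, so that it can then be replaced by an arbitrary tensor and reduced to pure tensors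
  -- in turn.
  have key : ∀ Λ : Module.End R (U q g δ c₁ ⊗[R] (U q g δ c₂ ⊗[R] U q g δ c₃)),
      (∀ a b, (∀ (t : grading q g δ c₁ ᵍ⊗[R] grading q g δ c₂), comul q δ c₁ c₂ hg h₁₂ a = t →
        comulLeft q δ hg h₁₂ c₃ (comulGen q g δ c₁₂ c₃ x * tmul R a b) =
        Λ (tensorLeft q δ t b))) →
      (∀ a b, (∀ (t : grading q g δ c₂ ᵍ⊗[R] grading q g δ c₃), comul q δ c₂ c₃ hg h₂₃ b = t →
        comulRight q δ hg h₂₃ c₁ (comulGen q g δ c₁ c₂₃ x * tmul R a b) =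
        Λ (tensorRight q δ a t))) →
    ∃ Λ : Module.End R (U q g δ c₁ ⊗[R] (U q g δ c₂ ⊗[R] U q g δ c₃)),
      (∀ u, comulLeft q δ hg h₁₂ c₃ (comulGen q g δ c₁₂ c₃ x * u) =
        Λ (comulLeft q δ hg h₁₂ c₃ u)) ∧
      ∀ u, comulRight q δ hg h₂₃ c₁ (comulGen q g δ c₁ c₂₃ x * u) =
        Λ (comulRight q δ hg h₂₃ c₁ u) := by
    intro Λ h h'
    refine ⟨Λ, fun u => ?_, fun u => ?_⟩
    · induction u using tensor_induction with
      | htmul a b => rw [h a b _ rfl, comulLeft_tmul]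
      | hadd s t hs ht => rw [mul_add, map_add, hs, ht, map_add, map_add]
    · induction u using tensor_induction with
      | htmul a b => rw [h' a b _ rfl, comulRight_tmul]
      | hadd s t hs ht => rw [mul_add, map_add, hs, ht, map_add, map_add]
  cases x with
  | xPlus z =>
    -- The iterated coproduct is `x⁺ ⊗ 1 ⊗ 1 + φ ⊗ x⁺ ⊗ 1 + φ ⊗ φ ⊗ x⁺`; in each summand `σ` acts on
    -- every leg to the left of `x⁺`, since `x⁺` has to pass the entries there.
    refine key (TensorProduct.map (ℓ E(c₁,.xPlus z)) LinearMap.id +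
      TensorProduct.map (ℓ E(c₁,.phi (z * qPow q (c₁ / 2))) ∘ₗ σ c₁)
        (TensorProduct.map (ℓ E(c₂,.xPlus (z * qPow q c₁))) LinearMap.id) +
      TensorProduct.map (ℓ E(c₁,.phi (z * qPow q (c₁ / 2))) ∘ₗ σ c₁)
        (TensorProduct.map (ℓ E(c₂,.phi (z * qPow q (c₁ + c₂ / 2))) ∘ₗ σ c₂)
          (ℓ E(c₃,.xPlus (z * qPow q (c₁ + c₂)))))) ?_ ?_
    · intro a b t ht
      have e₁ : z * qPow q ((c₁ + c₂) / 2) * qPow q (-(c₂ / 2)) = z * qPow q (c₁ / 2) := by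
        rw [mul_qPow_mul_qPow]; congr 2; ring
      have e₂ : z * qPow q ((c₁ + c₂) / 2) * qPow q (c₁ / 2) = z * qPow q (c₁ + c₂ / 2) := by
        rw [mul_qPow_mul_qPow]; congr 2; ring
      subst h₁₂
      simp only [comulGen, add_mul, tmul_mul_tmul_of_even one_mem_grading,
        tmul_mul_tmul_of_odd (mk_xPlus_mem _), map_add, comulLeft_tmul, map_mul, comul_mk,
        ← tensorParity_comul, ht, one_mul, e₁, e₂]
      clear ht
      induction t using tensor_induction with
      | hadd s t hs ht =>
        simp only [mul_add, map_add, tensorLeft_add] at hs ht ⊢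
        rw [← hs, ← ht]
        abel
      | htmul a' b' =>
        simp [tensorParity_tmul, tmul_mul_tmul_of_even one_mem_grading,
          tmul_mul_tmul_of_even (mk_phi_mem _), tmul_mul_tmul_of_odd (mk_xPlus_mem _),
          tensorLeft_add, tensorLeft_tmul]
    · intro a b t ht
      subst h₂₃
      simp only [comulGen, add_mul, tmul_mul_tmul_of_even one_mem_grading,
        tmul_mul_tmul_of_odd (mk_xPlus_mem _), map_add, comulRight_tmul, map_mul, comul_mk,
        ht, one_mul, mul_qPow_mul_qPow]
      clear ht
      induction t using tensor_induction with
      | hadd s t hs ht =>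
        simp only [mul_add, map_add, tensorRight_add] at hs ht ⊢
        rw [← hs, ← ht]
        abel
      | htmul a' b' =>
        simp [tmul_mul_tmul_of_even one_mem_grading,
          tmul_mul_tmul_of_odd (mk_xPlus_mem _), tensorRight_add, tensorRight_tmul]
        abel
  | xMinus z =>
    -- Here the iterated coproduct is `1 ⊗ 1 ⊗ x⁻ + 1 ⊗ x⁻ ⊗ ψ + x⁻ ⊗ ψ ⊗ ψ`, with the same rule for
    -- `σ`.
    refine key (TensorProduct.map (σ c₁) (TensorProduct.map (σ c₂) (ℓ E(c₃,.xMinus z))) +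
      TensorProduct.map (σ c₁) (TensorProduct.map (ℓ E(c₂,.xMinus (z * qPow q c₃)))
        (ℓ E(c₃,.psi (z * qPow q (c₃ / 2))))) +
      TensorProduct.map (ℓ E(c₁,.xMinus (z * qPow q (c₃ + c₂))))
        (TensorProduct.map (ℓ E(c₂,.psi (z * qPow q (c₃ + c₂ / 2))))
          (ℓ E(c₃,.psi (z * qPow q (c₃ / 2)))))) ?_ ?_
    · intro a b t ht
      subst h₁₂
      simp only [comulGen, add_mul, tmul_mul_tmul_of_even (mk_psi_mem _),
        tmul_mul_tmul_of_odd (mk_xMinus_mem _), map_add, comulLeft_tmul, map_mul, comul_mk,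
        ← tensorParity_comul, ht, one_mul, mul_qPow_mul_qPow]
      clear ht
      induction t using tensor_induction with
      | hadd s t hs ht =>
        simp only [mul_add, map_add, tensorLeft_add] at hs ht ⊢
        rw [← hs, ← ht]
        abel
      | htmul a' b' =>
        simp [tensorParity_tmul, tmul_mul_tmul_of_even (mk_psi_mem _),
          tmul_mul_tmul_of_odd (mk_xMinus_mem _), tensorLeft_add, tensorLeft_tmul]
        abel
    · intro a b t ht
      have e₁ : z * qPow q ((c₂ + c₃) / 2) * qPow q (c₃ / 2) = z * qPow q (c₃ + c₂ / 2) := by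
        rw [mul_qPow_mul_qPow]; congr 2; ring
      have e₂ : z * qPow q ((c₂ + c₃) / 2) * qPow q (-(c₂ / 2)) = z * qPow q (c₃ / 2) := by
        rw [mul_qPow_mul_qPow]; congr 2; ring
      have e₃ : z * qPow q (c₂ + c₃) = z * qPow q (c₃ + c₂) := by rw [add_comm]
      subst h₂₃
      simp only [comulGen, add_mul, tmul_mul_tmul_of_even (mk_psi_mem _),
        tmul_mul_tmul_of_odd (mk_xMinus_mem _), map_add, comulRight_tmul, map_mul, comul_mk,
        ht, one_mul, e₁, e₂, e₃]
      clear ht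
      induction t using tensor_induction with
      | hadd s t hs ht =>
        simp only [mul_add, map_add, tensorRight_add] at hs ht ⊢
        rw [← hs, ← ht]
        abel
      | htmul a' b' =>
        simp [tmul_mul_tmul_of_even (mk_psi_mem _),
          tmul_mul_tmul_of_odd (mk_xMinus_mem _), tensorRight_add, tensorRight_tmul]
  | phi z =>
    refine key (TensorProduct.map (ℓ E(c₁,.phi (z * qPow q (-((c₂ + c₃) / 2)))))
      (TensorProduct.map (ℓ E(c₂,.phi (z * qPow q (c₁ / 2 + -(c₃ / 2)))))
        (ℓ E(c₃,.phi (z * qPow q ((c₁ + c₂) / 2)))))) ?_ ?_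
    · intro a b t ht
      have e₁ : z * qPow q (-(c₃ / 2)) * qPow q (-(c₂ / 2)) = z * qPow q (-((c₂ + c₃) / 2)) := by
        rw [mul_qPow_mul_qPow]; congr 2; ring
      have e₂ : z * qPow q (-(c₃ / 2)) * qPow q (c₁ / 2) = z * qPow q (c₁ / 2 + -(c₃ / 2)) := by
        rw [mul_qPow_mul_qPow]; congr 2; ring
      subst h₁₂
      simp only [comulGen, tmul_mul_tmul_of_even (mk_phi_mem _), comulLeft_tmul, map_mul,
        comul_mk, ht, e₁, e₂]
      clear ht
      induction t using tensor_induction with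
      | hadd s t hs ht => rw [mul_add, tensorLeft_add, tensorLeft_add, map_add, hs, ht]
      | htmul a' b' => simp [tmul_mul_tmul_of_even (mk_phi_mem _), tensorLeft_tmul]
    · intro a b t ht
      have e₁ : z * qPow q (c₁ / 2) * qPow q (-(c₃ / 2)) = z * qPow q (c₁ / 2 + -(c₃ / 2)) := by
        rw [mul_qPow_mul_qPow]
      have e₂ : z * qPow q (c₁ / 2) * qPow q (c₂ / 2) = z * qPow q ((c₁ + c₂) / 2) := by
        rw [mul_qPow_mul_qPow]; congr 2; ring
      subst h₂₃
      simp only [comulGen, tmul_mul_tmul_of_even (mk_phi_mem _), comulRight_tmul, map_mul,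
        comul_mk, ht, e₁, e₂]
      clear ht
      induction t using tensor_induction with
      | hadd s t hs ht => rw [mul_add, tensorRight_add, tensorRight_add, map_add, hs, ht]
      | htmul a' b' => simp [tmul_mul_tmul_of_even (mk_phi_mem _), tensorRight_tmul]
  | phiInv z =>
    refine key (TensorProduct.map (ℓ E(c₁,.phiInv (z * qPow q (-((c₂ + c₃) / 2)))))
      (TensorProduct.map (ℓ E(c₂,.phiInv (z * qPow q (c₁ / 2 + -(c₃ / 2)))))
        (ℓ E(c₃,.phiInv (z * qPow q ((c₁ + c₂) / 2)))))) ?_ ?_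
    · intro a b t ht
      have e₁ : z * qPow q (-(c₃ / 2)) * qPow q (-(c₂ / 2)) = z * qPow q (-((c₂ + c₃) / 2)) := by
        rw [mul_qPow_mul_qPow]; congr 2; ring
      have e₂ : z * qPow q (-(c₃ / 2)) * qPow q (c₁ / 2) = z * qPow q (c₁ / 2 + -(c₃ / 2)) := by
        rw [mul_qPow_mul_qPow]; congr 2; ring
      subst h₁₂
      simp only [comulGen, tmul_mul_tmul_of_even (phiInv_mem _), comulLeft_tmul, map_mul,
        comul_mk, ht, e₁, e₂]
      clear ht
      induction t using tensor_induction with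
      | hadd s t hs ht => rw [mul_add, tensorLeft_add, tensorLeft_add, map_add, hs, ht]
      | htmul a' b' => simp [tmul_mul_tmul_of_even (phiInv_mem _), tensorLeft_tmul]
    · intro a b t ht
      have e₁ : z * qPow q (c₁ / 2) * qPow q (-(c₃ / 2)) = z * qPow q (c₁ / 2 + -(c₃ / 2)) := by
        rw [mul_qPow_mul_qPow]
      have e₂ : z * qPow q (c₁ / 2) * qPow q (c₂ / 2) = z * qPow q ((c₁ + c₂) / 2) := by
        rw [mul_qPow_mul_qPow]; congr 2; ring
      subst h₂₃
      simp only [comulGen, tmul_mul_tmul_of_even (phiInv_mem _), comulRight_tmul, map_mul,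
        comul_mk, ht, e₁, e₂]
      clear ht
      induction t using tensor_induction with
      | hadd s t hs ht => rw [mul_add, tensorRight_add, tensorRight_add, map_add, hs, ht]
      | htmul a' b' => simp [tmul_mul_tmul_of_even (phiInv_mem _), tensorRight_tmul]
  | psi z =>
    refine key (TensorProduct.map (ℓ E(c₁,.psi (z * qPow q ((c₂ + c₃) / 2))))
      (TensorProduct.map (ℓ E(c₂,.psi (z * qPow q (-(c₁ / 2) + c₃ / 2))))
        (ℓ E(c₃,.psi (z * qPow q (-((c₁ + c₂) / 2))))))) ?_ ?_
    · intro a b t ht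
      have e₁ : z * qPow q (c₃ / 2) * qPow q (c₂ / 2) = z * qPow q ((c₂ + c₃) / 2) := by
        rw [mul_qPow_mul_qPow]; congr 2; ring
      have e₂ : z * qPow q (c₃ / 2) * qPow q (-(c₁ / 2)) = z * qPow q (-(c₁ / 2) + c₃ / 2) := by
        rw [mul_qPow_mul_qPow]; congr 2; ring
      subst h₁₂
      simp only [comulGen, tmul_mul_tmul_of_even (mk_psi_mem _), comulLeft_tmul, map_mul,
        comul_mk, ht, e₁, e₂]
      clear ht
      induction t using tensor_induction with
      | hadd s t hs ht => rw [mul_add, tensorLeft_add, tensorLeft_add, map_add, hs, ht]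
      | htmul a' b' => simp [tmul_mul_tmul_of_even (mk_psi_mem _), tensorLeft_tmul]
    · intro a b t ht
      have e₁ : z * qPow q (-(c₁ / 2)) * qPow q (c₃ / 2) = z * qPow q (-(c₁ / 2) + c₃ / 2) := by
        rw [mul_qPow_mul_qPow]
      have e₂ : z * qPow q (-(c₁ / 2)) * qPow q (-(c₂ / 2)) = z * qPow q (-((c₁ + c₂) / 2)) := by
        rw [mul_qPow_mul_qPow]; congr 2; ring
      subst h₂₃
      simp only [comulGen, tmul_mul_tmul_of_even (mk_psi_mem _), comulRight_tmul, map_mul,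
        comul_mk, ht, e₁, e₂]
      clear ht
      induction t using tensor_induction with
      | hadd s t hs ht => rw [mul_add, tensorRight_add, tensorRight_add, map_add, hs, ht]
      | htmul a' b' => simp [tmul_mul_tmul_of_even (mk_psi_mem _), tensorRight_tmul]
  | psiInv z =>
    refine key (TensorProduct.map (ℓ E(c₁,.psiInv (z * qPow q ((c₂ + c₃) / 2))))
      (TensorProduct.map (ℓ E(c₂,.psiInv (z * qPow q (-(c₁ / 2) + c₃ / 2))))
        (ℓ E(c₃,.psiInv (z * qPow q (-((c₁ + c₂) / 2))))))) ?_ ?_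
    · intro a b t ht
      have e₁ : z * qPow q (c₃ / 2) * qPow q (c₂ / 2) = z * qPow q ((c₂ + c₃) / 2) := by
        rw [mul_qPow_mul_qPow]; congr 2; ring
      have e₂ : z * qPow q (c₃ / 2) * qPow q (-(c₁ / 2)) = z * qPow q (-(c₁ / 2) + c₃ / 2) := by
        rw [mul_qPow_mul_qPow]; congr 2; ring
      subst h₁₂
      simp only [comulGen, tmul_mul_tmul_of_even (psiInv_mem _), comulLeft_tmul, map_mul,
        comul_mk, ht, e₁, e₂]
      clear ht
      induction t using tensor_induction with
      | hadd s t hs ht => rw [mul_add, tensorLeft_add, tensorLeft_add, map_add, hs, ht]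
      | htmul a' b' => simp [tmul_mul_tmul_of_even (psiInv_mem _), tensorLeft_tmul]
    · intro a b t ht
      have e₁ : z * qPow q (-(c₁ / 2)) * qPow q (c₃ / 2) = z * qPow q (-(c₁ / 2) + c₃ / 2) := by
        rw [mul_qPow_mul_qPow]
      have e₂ : z * qPow q (-(c₁ / 2)) * qPow q (-(c₂ / 2)) = z * qPow q (-((c₁ + c₂) / 2)) := by
        rw [mul_qPow_mul_qPow]; congr 2; ring
      subst h₂₃
      simp only [comulGen, tmul_mul_tmul_of_even (psiInv_mem _), comulRight_tmul, map_mul,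
        comul_mk, ht, e₁, e₂]
      clear ht
      induction t using tensor_induction with
      | hadd s t hs ht => rw [mul_add, tensorRight_add, tensorRight_add, map_add, hs, ht]
      | htmul a' b' => simp [tmul_mul_tmul_of_even (psiInv_mem _), tensorRight_tmul]

theorem coassoc (h₁₂ : c₁₂ = c₁ + c₂) (h₂₃ : c₂₃ = c₂ + c₃) (h : c = c₁₂ + c₃)
    (h' : c = c₁ + c₂₃) (a : U q g δ c) :
    comulLeft q δ hg h₁₂ c₃ (comul q δ c₁₂ c₃ hg h a) =
      comulRight q δ hg h₂₃ c₁ (comul q δ c₁ c₂₃ hg h' a) := by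
  have key : ∃ Λ : Module.End R (U q g δ c₁ ⊗[R] (U q g δ c₂ ⊗[R] U q g δ c₃)),
      (∀ u, comulLeft q δ hg h₁₂ c₃ (comul q δ c₁₂ c₃ hg h a * u) =
        Λ (comulLeft q δ hg h₁₂ c₃ u)) ∧
      ∀ u, comulRight q δ hg h₂₃ c₁ (comul q δ c₁ c₂₃ hg h' a * u) =
        Λ (comulRight q δ hg h₂₃ c₁ u) := by
    induction a using U_induction with
    | halg r =>
      refine ⟨r • LinearMap.id, fun u => ?_, fun u => ?_⟩ <;>
        rw [AlgHom.commutes, ← Algebra.smul_def, map_smul, LinearMap.smul_apply, LinearMap.id_apply]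
    | hgen x =>
      obtain ⟨Λ, hl, hr⟩ := exists_left_mul_comulGen q δ hg h₁₂ h₂₃ x
      exact ⟨Λ, fun u => by rw [comul_mk, hl], fun u => by rw [comul_mk, hr]⟩
    | hmul a b ha hb =>
      obtain ⟨Λ, hl, hr⟩ := ha
      obtain ⟨Λ', hl', hr'⟩ := hb
      exact ⟨Λ ∘ₗ Λ', fun u => by rw [map_mul (comul q δ _ _ hg _), mul_assoc, hl, hl',
        LinearMap.comp_apply],
        fun u => by rw [map_mul (comul q δ _ _ hg _), mul_assoc, hr, hr', LinearMap.comp_apply]⟩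
    | hadd a b ha hb =>
      obtain ⟨Λ, hl, hr⟩ := ha
      obtain ⟨Λ', hl', hr'⟩ := hb
      exact ⟨Λ + Λ', fun u => by rw [map_add, add_mul, map_add, hl, hl', LinearMap.add_apply],
        fun u => by rw [map_add, add_mul, map_add, hr, hr', LinearMap.add_apply]⟩
  obtain ⟨Λ, hl, hr⟩ := key
  -- Both `Δ ⊗ id` and `id ⊗ Δ` send the unit to `1 ⊗ (1 ⊗ 1)`, so the two sides are the same `Λ`
  -- applied to the same vector.
  have hl1 := hl 1
  have hr1 := hr 1
  rw [mul_one, ← one_tmul_one, comulLeft_tmul, map_one, ← one_tmul_one, tensorLeft_tmul] at hl1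
  rw [mul_one, ← one_tmul_one, comulRight_tmul, map_one, ← one_tmul_one, tensorRight_tmul] at hr1
  rw [hl1, hr1]

end Coassoc

/-! ### The counit -/

section Counit

open GradedTensorProduct (tmul)

variable {R : Type u} [CommRing R] [Algebra ℂ R] (q : ℂˣ) (g : ℂˣ → ℂˣ) (δ : ℂˣ → R) (c : ℂ)

local notation "E(" c "," x ")" => mk q g δ c x

/-- The counit on the generators. -/
def counitGen (R : Type u) [CommRing R] : Gen → R
  | .xPlus _ => 0
  | .xMinus _ => 0
  | .phi _ => 1
  | .phiInv _ => 1
  | .psi _ => 1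
  | .psiInv _ => 1

/-- At central value `0` the commutator scalar of `φ` and `ψ` is `1`, and the two `δ` terms have the
same coefficient, so they cancel when `φ` and `ψ` both go to `1`. -/
theorem counitGen_isRealization : IsRealization q g δ 0 (counitGen R) := by
  constructor <;> intros <;> simp [counitGen, scal_one]

/-- The counit. -/
def counit : U q g δ 0 →ₐ[R] R := (counitGen_isRealization q g δ).lift

theorem counit_mk (x : Gen) : counit q g δ E(0,x) = counitGen R x := IsRealization.lift_mk _ x

theorem counit_parity (a : U q g δ 0) : counit q g δ (parity q g δ 0 a) = counit q g δ a := by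
  induction a using U_induction with
  | halg r => rw [AlgHom.commutes]
  | hgen x => cases x <;> simp [parity_mk, counit_mk, Gen.sign, counitGen]
  | hmul a b ha hb => rw [map_mul, map_mul, ha, hb, map_mul]
  | hadd a b ha hb => rw [map_add, map_add, ha, hb, map_add]

theorem counit_of_odd {a : U q g δ 0} (ha : a ∈ grading q g δ 0 1) : counit q g δ a = 0 := by
  have h := counit_parity q g δ a
  rw [parity_of_odd ha, map_neg] at h
  have h2 : counit q g δ a + counit q g δ a = 0 := by nth_rw 1 [← h]; ring
  rw [← one_mul (counit q g δ a), ← half_add_half, add_mul, ← mul_add, h2, mul_zero]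

/-- `ε ⊗ id`. -/
noncomputable def counitLeft : grading q g δ 0 ᵍ⊗[R] grading q g δ c →ₗ[R] U q g δ c :=
  (TensorProduct.lid R (U q g δ c)).toLinearMap ∘ₗ
    TensorProduct.map (counit q g δ).toLinearMap LinearMap.id ∘ₗ
    (GradedTensorProduct.of R (grading q g δ 0) (grading q g δ c)).symm.toLinearMap

/-- `id ⊗ ε`. -/
noncomputable def counitRight : grading q g δ c ᵍ⊗[R] grading q g δ 0 →ₗ[R] U q g δ c :=
  (TensorProduct.rid R (U q g δ c)).toLinearMap ∘ₗ
    TensorProduct.map LinearMap.id (counit q g δ).toLinearMap ∘ₗ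
    (GradedTensorProduct.of R (grading q g δ c) (grading q g δ 0)).symm.toLinearMap

theorem counitLeft_tmul (a : U q g δ 0) (b : U q g δ c) :
    counitLeft q g δ c (tmul R a b) = counit q g δ a • b := rfl

theorem counitRight_tmul (a : U q g δ c) (b : U q g δ 0) :
    counitRight q g δ c (tmul R a b) = counit q g δ b • a := rfl

variable {g}

/-- The strengthened form says that `ε ⊗ id` turns left multiplication by `Δ(a)` into left
multiplication by `a`. Signs disappear because `ε` is invariant under parity. -/
theorem counitLeft_comul (hg : ∀ z, g z = (g z⁻¹)⁻¹) (h : c = 0 + c) (a : U q g δ c) :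
    counitLeft q g δ c (comul q δ 0 c hg h a) = a := by
  have key : ∀ u, counitLeft q g δ c (comul q δ 0 c hg h a * u) = a * counitLeft q g δ c u := by
    induction a using U_induction with
    | halg r =>
      intro u
      rw [AlgHom.commutes, ← Algebra.smul_def, map_smul, Algebra.smul_def]
    | hgen x =>
      intro u
      induction u using tensor_induction with
      | hadd s t hs ht => rw [mul_add, map_add, hs, ht, map_add, mul_add]
      | htmul a b =>
        rw [comul_mk]
        cases x <;>
        simp [comulGen, add_mul, tmul_mul_tmul_of_even one_mem_grading,
          tmul_mul_tmul_of_even (mk_phi_mem _), tmul_mul_tmul_of_even (mk_psi_mem _),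
          tmul_mul_tmul_of_even (phiInv_mem _), tmul_mul_tmul_of_even (psiInv_mem _),
          tmul_mul_tmul_of_odd (mk_xPlus_mem _), tmul_mul_tmul_of_odd (mk_xMinus_mem _),
          counitLeft_tmul,
          counit_parity, counit_mk, counitGen, qPow_zero]
    | hmul a b ha hb => intro u; rw [map_mul (comul q δ _ _ hg _), mul_assoc, ha, hb, mul_assoc]
    | hadd a b ha hb => intro u; rw [map_add, add_mul, map_add, ha, hb, add_mul]
  have h1 := key 1
  rwa [mul_one, ← one_tmul_one, counitLeft_tmul, map_one, one_smul, mul_one] at h1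

theorem counitRight_comul (hg : ∀ z, g z = (g z⁻¹)⁻¹) (h : c = c + 0) (a : U q g δ c) :
    counitRight q g δ c (comul q δ c 0 hg h a) = a := by
  have key : ∀ u, counitRight q g δ c (comul q δ c 0 hg h a * u) = a * counitRight q g δ c u := by
    induction a using U_induction with
    | halg r =>
      intro u
      rw [AlgHom.commutes, ← Algebra.smul_def, map_smul, Algebra.smul_def]
    | hgen x =>
      intro u
      induction u using tensor_induction with
      | hadd s t hs ht => rw [mul_add, map_add, hs, ht, map_add, mul_add]
      | htmul a b =>
        rw [comul_mk]
        cases x <;>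
        simp [comulGen, add_mul, tmul_mul_tmul_of_even one_mem_grading,
          tmul_mul_tmul_of_even (mk_phi_mem _), tmul_mul_tmul_of_even (mk_psi_mem _),
          tmul_mul_tmul_of_even (phiInv_mem _), tmul_mul_tmul_of_even (psiInv_mem _),
          tmul_mul_tmul_of_odd (mk_xPlus_mem _), tmul_mul_tmul_of_odd (mk_xMinus_mem _),
          counitRight_tmul,
          counit_mk, counitGen, qPow_zero]
    | hmul a b ha hb => intro u; rw [map_mul (comul q δ _ _ hg _), mul_assoc, ha, hb, mul_assoc]
    | hadd a b ha hb => intro u; rw [map_add, add_mul, map_add, ha, hb, add_mul]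
  have h1 := key 1
  rwa [mul_one, ← one_tmul_one, counitRight_tmul, map_one, one_smul, mul_one] at h1

end Counit

/-! ### Conjugation of products and of inverses -/

section ConjInv

variable {R A : Type*} [CommRing R] [Ring A] [Algebra R A] {a a' x x' y : A}

theorem conj_mul_of_conj {r s : R} (ha : a' * a = 1) (hx : a * x * a' = r • x)
    (hy : a * y * a' = s • y) : a * (x * y) * a' = (r * s) • (x * y) := by
  calc a * (x * y) * a' = a * x * (1 * y) * a' := by simp only [one_mul, mul_assoc]
    _ = (a * x * a') * (a * y * a') := by rw [← ha]; simp only [mul_assoc]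
    _ = (r * s) • (x * y) := by rw [hx, hy, smul_mul_smul_comm]

/-- Conjugation is multiplicative, so it scales the inverse of an eigenvector by the inverse
eigenvalue. -/
theorem conj_inv_of_conj {r s : R} (ha : a' * a = 1) (ha' : a * a' = 1) (hx : x * x' = 1)
    (hx' : x' * x = 1) (hsr : s * r = 1) (h : a * x * a' = r • x) : a * x' * a' = s • x' := by
  have h₁ : (a * x * a') * (a * x' * a') = 1 := by
    calc (a * x * a') * (a * x' * a') = a * (x * ((a' * a) * x')) * a' := by
          simp only [mul_assoc]
      _ = 1 := by rw [ha, one_mul, hx, mul_one, ha']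
  calc a * x' * a' = x' * x * (a * x' * a') := by rw [hx', one_mul]
    _ = (s * r) • (x' * x * (a * x' * a')) := by rw [hsr, one_smul]
    _ = s • (x' * ((r • x) * (a * x' * a'))) := by
      rw [smul_mul_assoc, mul_smul_comm, smul_smul, mul_assoc x']
    _ = s • x' := by rw [← h, h₁, mul_one]

theorem mul_inv_eq_of_conj {r : R} (ha : a' * a = 1) (h : a * x * a' = r • x) :
    x * a' = r • (a' * x) := by
  rw [← mul_smul_comm, ← h, ← mul_assoc, ← mul_assoc, ha, one_mul]

theorem inv_mul_eq_of_conj {r s : R} (ha : a' * a = 1) (hsr : s * r = 1) (h : a * x * a' = r • x) :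
    a' * x = s • (x * a') := by
  rw [mul_inv_eq_of_conj ha h, smul_smul, hsr, one_smul]

end ConjInv

/-! ### The relations satisfied by the antipode images -/

section Antipode

open MulOpposite (op unop)

variable {R : Type u} [CommRing R] [Algebra ℂ R] (q : ℂˣ) (g : ℂˣ → ℂˣ) (δ : ℂˣ → R) (c : ℂ)

local notation "E(" c "," x ")" => mk q g δ c x

theorem phiInv_mul_phiInv (z w : ℂˣ) :
    E(c,.phiInv z) * E(c,.phiInv w) = E(c,.phiInv w) * E(c,.phiInv z) :=
  congrArg (fun u : (U q g δ c)ˣ => ((u⁻¹ : (U q g δ c)ˣ) : U q g δ c))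
    (show phi q g δ c w * phi q g δ c z = phi q g δ c z * phi q g δ c w from
      Units.ext (phi_mul_phi q g δ c w z))

theorem psiInv_mul_psiInv (z w : ℂˣ) :
    E(c,.psiInv z) * E(c,.psiInv w) = E(c,.psiInv w) * E(c,.psiInv z) :=
  congrArg (fun u : (U q g δ c)ˣ => ((u⁻¹ : (U q g δ c)ˣ) : U q g δ c))
    (show psi q g δ c w * psi q g δ c z = psi q g δ c z * psi q g δ c w from
      Units.ext (psi_mul_psi q g δ c w z))

theorem phi_conj_phiInv (z w : ℂˣ) :
    E(c,.phi z) * E(c,.phiInv w) * E(c,.phiInv z) = (1 : R) • E(c,.phiInv w) :=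
  conj_inv_of_conj (r := (1 : R)) (phiInv_mul_phi _ _ _ _ _) (phi_mul_phiInv _ _ _ _ _)
    (phi_mul_phiInv _ _ _ _ _) (phiInv_mul_phi _ _ _ _ _) (one_mul 1)
    (by rw [phi_conj_phi, one_smul])

theorem psi_conj_psiInv (z w : ℂˣ) :
    E(c,.psi z) * E(c,.psiInv w) * E(c,.psiInv z) = (1 : R) • E(c,.psiInv w) :=
  conj_inv_of_conj (r := (1 : R)) (psiInv_mul_psi _ _ _ _ _) (psi_mul_psiInv _ _ _ _ _)
    (psi_mul_psiInv _ _ _ _ _) (psiInv_mul_psi _ _ _ _ _) (one_mul 1)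
    (by rw [psi_conj_psi, one_smul])

theorem phi_conj_psiInv (z w : ℂˣ) :
    E(c,.phi z) * E(c,.psiInv w) * E(c,.phiInv z) =
      scal R (g (z / w * qPow q c) / g (z / w * qPow q (-c))) • E(c,.psiInv w) :=
  conj_inv_of_conj (phiInv_mul_phi _ _ _ _ _) (phi_mul_phiInv _ _ _ _ _)
    (psi_mul_psiInv _ _ _ _ _) (psiInv_mul_psi _ _ _ _ _)
    (by rw [scal_mul, div_mul_div_cancel, div_self', scal_one]) (phi_conj_psi q g δ c z w)

theorem psi_conj_phiInv (z w : ℂˣ) :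
    E(c,.psi w) * E(c,.phiInv z) * E(c,.psiInv w) =
      scal R (g (z / w * qPow q (-c)) / g (z / w * qPow q c)) • E(c,.phiInv z) :=
  conj_inv_of_conj (psiInv_mul_psi _ _ _ _ _) (psi_mul_psiInv _ _ _ _ _)
    (phi_mul_phiInv _ _ _ _ _) (phiInv_mul_phi _ _ _ _ _)
    (by rw [scal_mul, div_mul_div_cancel, div_self', scal_one]) (psi_conj_phi q g δ c z w)

/-- The antipode on `x⁺(z)`, up to sign. -/
noncomputable def antiPlus (z : ℂˣ) : U q g δ c :=
  E(c,.phiInv (z * qPow q (-(c / 2)))) * E(c,.xPlus (z * qPow q (-c)))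

/-- The antipode on `x⁻(z)`, up to sign. -/
noncomputable def antiMinus (z : ℂˣ) : U q g δ c :=
  E(c,.xMinus (z * qPow q (-c))) * E(c,.psiInv (z * qPow q (-(c / 2))))

variable (R) in
/-- The imaginary unit as a scalar in `R`. -/
def imag : R := algebraMap ℂ R Complex.I

variable (R) in
theorem imag_mul_imag : imag R * imag R = -1 := by
  rw [imag, ← map_mul, Complex.I_mul_I, map_neg, map_one]

/-- The images of the generators under the antipode multiplied by `(-i) ^ deg`, which is an ordinary
anti-homomorphism. -/
noncomputable def antiGen : Gen → (U q g δ c)ᵐᵒᵖ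
  | .xPlus z => op (imag R • antiPlus q g δ c z)
  | .xMinus z => op (imag R • antiMinus q g δ c z)
  | .phi z => op E(c,.phiInv z)
  | .phiInv z => op E(c,.phi z)
  | .psi z => op E(c,.psiInv z)
  | .psiInv z => op E(c,.psi z)

theorem phi_conj_antiPlus (z w : ℂˣ) :
    E(c,.phi z) * antiPlus q g δ c w * E(c,.phiInv z) =
      scal R (g (z / w * qPow q (c / 2))) • antiPlus q g δ c w := by
  rw [antiPlus, conj_mul_of_conj (phiInv_mul_phi _ _ _ _ _) (phi_conj_phiInv _ _ _ _ _ _)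
    (phi_conj_xPlus _ _ _ _ _ _), one_mul, div_mul_qPow, mul_qPow_mul_qPow]
  ring_nf

theorem psi_conj_antiMinus (z w : ℂˣ) :
    E(c,.psi z) * antiMinus q g δ c w * E(c,.psiInv z) =
      scal R (g (w / z * qPow q (-(c / 2)))) • antiMinus q g δ c w := by
  rw [antiMinus, conj_mul_of_conj (psiInv_mul_psi _ _ _ _ _) (psi_conj_xMinus _ _ _ _ _ _)
    (psi_conj_psiInv _ _ _ _ _ _), mul_one, mul_qPow_div, mul_qPow_mul_qPow]
  ring_nf

theorem phi_conj_antiMinus (z w : ℂˣ) :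
    E(c,.phi z) * antiMinus q g δ c w * E(c,.phiInv z) =
      scal R (g (z / w * qPow q (-(c / 2))))⁻¹ • antiMinus q g δ c w := by
  rw [antiMinus, conj_mul_of_conj (phiInv_mul_phi _ _ _ _ _) (phi_conj_xMinus _ _ _ _ _ _)
    (phi_conj_psiInv _ _ _ _ _ _), scal_mul]
  simp only [div_mul_qPow, mul_qPow_mul_qPow]
  -- The factor `x⁻` gives the inverse of `g(z/w q^(3c/2))`, which cancels the numerator contributed
  -- by the inverse of `ψ` and leaves the inverse of `g(z/w q^(-c/2))`.
  rw [show - -c + c / 2 = - -(c / 2) + c by ring, inv_mul_eq_div, div_div_cancel_left]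
  ring_nf

theorem psi_conj_antiPlus (z w : ℂˣ) :
    E(c,.psi z) * antiPlus q g δ c w * E(c,.psiInv z) =
      scal R (g (w / z * qPow q (c / 2)))⁻¹ • antiPlus q g δ c w := by
  rw [antiPlus, conj_mul_of_conj (psiInv_mul_psi _ _ _ _ _) (psi_conj_phiInv _ _ _ _ _ _)
    (psi_conj_xPlus _ _ _ _ _ _), scal_mul]
  simp only [mul_qPow_div, mul_qPow_mul_qPow]
  rw [show -c + -(c / 2) = -(c / 2) + -c by ring, div_mul_eq_mul_div, mul_inv_cancel, one_div]
  ring_nf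

/-- In both products the inverse of `φ` can be moved to the far left and the inverse of `ψ` to the
far right, with scalars that cancel. The anticommutator of `x⁺` and `x⁻` is then sandwiched between
them, and each of its terms `ψ`, `φ` cancels against one of the two inverses. -/
theorem antiMinus_mul_antiPlus_add (z w : ℂˣ) :
    antiMinus q g δ c w * antiPlus q g δ c z + antiPlus q g δ c z * antiMinus q g δ c w =
      algebraMap ℂ R (1 / ((q : ℂ) - (q : ℂ)⁻¹)) •
        (δ (z / w * qPow q (-c)) • E(c,.phiInv (z * qPow q (-(c / 2)))) -
          δ (z / w * qPow q c) • E(c,.psiInv (w * qPow q (-(c / 2))))) := by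
  set X := E(c,.xPlus (z * qPow q (-c)))
  set Y := E(c,.xMinus (w * qPow q (-c)))
  set F := E(c,.phiInv (z * qPow q (-(c / 2))))
  set P := E(c,.psiInv (w * qPow q (-(c / 2))))
  have h₁ : Y * P * F = scal R (g (z / w * qPow q (-c)))⁻¹ • (F * (Y * P)) := by
    have h := mul_inv_eq_of_conj (phiInv_mul_phi q g δ c (z * qPow q (-(c / 2))))
      (phi_conj_antiMinus q g δ c (z * qPow q (-(c / 2))) w)
    rwa [mul_qPow_div, mul_qPow_mul_qPow, ← neg_add, add_halves] at h
  have h₂ : P * X = scal R (g (z / w * qPow q (-c))) • (X * P) := by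
    have h := inv_mul_eq_of_conj (psiInv_mul_psi q g δ c (w * qPow q (-(c / 2)))) (scal_mul_inv R _)
      (psi_conj_xPlus q g δ c (w * qPow q (-(c / 2))) (z * qPow q (-c)))
    rwa [div_mul_qPow, mul_qPow_div, mul_qPow_mul_qPow, mul_qPow_mul_qPow,
      show -c + (- -(c / 2) + -(c / 2)) = -c by ring] at h
  have h₃ : Y * P * (F * X) = F * (Y * X) * P := by
    rw [← mul_assoc, h₁, smul_mul_assoc, mul_assoc, mul_assoc Y, h₂, mul_smul_comm, mul_smul_comm,
      smul_smul, scal_inv_mul, one_smul]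
    simp only [mul_assoc]
  have h₄ := xPlus_mul_xMinus_add q g δ c (z * qPow q (-c)) (w * qPow q (-c))
  rw [mul_div_mul_right_eq_div, mul_qPow_mul_qPow, mul_qPow_mul_qPow,
    show -c + c / 2 = -(c / 2) by ring] at h₄
  calc Y * P * (F * X) + F * X * (Y * P) = F * (X * Y + Y * X) * P := by
        rw [h₃]; simp only [mul_add, add_mul, mul_assoc]; abel
    _ = _ := by
      rw [h₄, mul_smul_comm, smul_mul_assoc, mul_sub, sub_mul, mul_smul_comm, smul_mul_assoc,
        mul_smul_comm, smul_mul_assoc, mul_assoc, psi_mul_psiInv, phiInv_mul_phi, mul_one, one_mul]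

variable {g}

/-- Collecting the inverses of `φ` on the left costs `g(z/w)` in one order and `g(w/z)` in the
other; by the symmetry of `g` these are inverse to each other, so the relation for `x⁺` itself gives
the claim. -/
theorem antiPlus_mul_antiPlus (hg : ∀ z, g z = (g z⁻¹)⁻¹) (z w : ℂˣ) :
    antiPlus q g δ c w * antiPlus q g δ c z =
      -(scal R (g (z / w)) • (antiPlus q g δ c z * antiPlus q g δ c w)) := by
  have h : ∀ z w, E(c,.xPlus (w * qPow q (-c))) * E(c,.phiInv (z * qPow q (-(c / 2)))) =
      scal R (g (z / w)) •
        (E(c,.phiInv (z * qPow q (-(c / 2)))) * E(c,.xPlus (w * qPow q (-c)))) := by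
    intro z w
    have h := mul_inv_eq_of_conj (phiInv_mul_phi q g δ c (z * qPow q (-(c / 2))))
      (phi_conj_xPlus q g δ c (z * qPow q (-(c / 2))) (w * qPow q (-c)))
    rwa [div_mul_qPow, mul_qPow_div, mul_qPow_mul_qPow, mul_qPow_mul_qPow,
      show -(c / 2) + (- -c + -(c / 2)) = 0 by ring, qPow_zero, mul_one] at h
  have h' : ∀ z w, antiPlus q g δ c w * antiPlus q g δ c z = scal R (g (z / w)) •
      (E(c,.phiInv (w * qPow q (-(c / 2)))) * E(c,.phiInv (z * qPow q (-(c / 2)))) *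
        (E(c,.xPlus (w * qPow q (-c))) * E(c,.xPlus (z * qPow q (-c))))) := by
    intro z w
    rw [antiPlus, antiPlus, mul_assoc, ← mul_assoc E(c,.xPlus _), h, smul_mul_assoc, mul_smul_comm]
    simp only [mul_assoc]
  rw [h' z w, h' w z, xPlus_mul_xPlus q g δ c (z * _), mul_div_mul_right_eq_div,
    phiInv_mul_phiInv q g δ c (z * _), mul_neg, mul_smul_comm, smul_neg, smul_smul, smul_neg,
    neg_neg, scal_mul, hg (w / z), inv_div, inv_mul_cancel, scal_one, one_smul]

theorem antiMinus_mul_antiMinus (hg : ∀ z, g z = (g z⁻¹)⁻¹) (z w : ℂˣ) :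
    antiMinus q g δ c w * antiMinus q g δ c z =
      -(scal R (g (z / w))⁻¹ • (antiMinus q g δ c z * antiMinus q g δ c w)) := by
  have h : ∀ z w, E(c,.psiInv (z * qPow q (-(c / 2)))) * E(c,.xMinus (w * qPow q (-c))) =
      scal R (g (z / w)) •
        (E(c,.xMinus (w * qPow q (-c))) * E(c,.psiInv (z * qPow q (-(c / 2))))) := by
    intro z w
    refine inv_mul_eq_of_conj (psiInv_mul_psi q g δ c (z * qPow q (-(c / 2)))) ?_
      (psi_conj_xMinus q g δ c (z * qPow q (-(c / 2))) (w * qPow q (-c)))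
    rw [div_mul_qPow, mul_qPow_div, mul_qPow_mul_qPow, mul_qPow_mul_qPow,
      show -c + (- -(c / 2) + c / 2) = 0 by ring, qPow_zero, mul_one, hg (w / z), inv_div,
      scal_mul_inv]
  have h' : ∀ z w, antiMinus q g δ c w * antiMinus q g δ c z = scal R (g (w / z)) •
      (E(c,.xMinus (w * qPow q (-c))) * E(c,.xMinus (z * qPow q (-c))) *
        (E(c,.psiInv (w * qPow q (-(c / 2)))) * E(c,.psiInv (z * qPow q (-(c / 2)))))) := by
    intro z w
    rw [antiMinus, antiMinus, mul_assoc, ← mul_assoc E(c,.psiInv _), h, smul_mul_assoc,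
      mul_smul_comm]
    simp only [mul_assoc]
  rw [h' z w, h' w z, xMinus_mul_xMinus q g δ c (z * _), mul_div_mul_right_eq_div,
    psiInv_mul_psiInv q g δ c (z * _), neg_mul, smul_mul_assoc, smul_neg, smul_smul, smul_neg,
    neg_neg, scal_mul, hg (w / z), inv_div, mul_inv_cancel, scal_one, one_smul]

/-- Reversing products has the same effect on the scalars as replacing `c` by `-c`. The factor `i *
i = -1` supplies the sign missing in the anticommutator of `x⁺` and `x⁻`, and is harmless in the
homogeneous quadratic relations. -/
theorem antiGen_isRealization (hg : ∀ z, g z = (g z⁻¹)⁻¹) {c' : ℂ} (hc : c' = -c) :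
    IsRealization q g δ c' (antiGen q g δ c) := by
  subst hc
  constructor <;> intros <;> apply MulOpposite.unop_injective <;>
    simp only [antiGen, MulOpposite.unop_mul, MulOpposite.unop_op, MulOpposite.unop_one,
      MulOpposite.unop_add, MulOpposite.unop_sub, MulOpposite.unop_neg, MulOpposite.unop_smul,
      MulOpposite.algebraMap_apply, neg_neg, neg_div]
  · apply phi_mul_phiInv
  · apply phiInv_mul_phi
  · apply psi_mul_psiInv
  · apply psiInv_mul_psi
  · apply phiInv_mul_phiInv
  · apply psiInv_mul_psiInv
  -- In the opposite algebra the commutator becomes that of `ψ(w)` and `φ(z)`, whose scalar is the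
  -- inverse one, as required at the central value `-c`.
  · rw [← mul_assoc, ← mul_assoc, psi_conj_phi, smul_mul_assoc, phi_mul_phiInv,
      Algebra.algebraMap_eq_smul_one]
  · rw [← mul_assoc, mul_smul_comm, smul_mul_assoc, phi_conj_antiPlus, smul_comm]
  · rw [← mul_assoc, mul_smul_comm, smul_mul_assoc, phi_conj_antiMinus, smul_comm]
  · rw [← mul_assoc, mul_smul_comm, smul_mul_assoc, psi_conj_antiPlus, smul_comm]
  · rw [← mul_assoc, mul_smul_comm, smul_mul_assoc, psi_conj_antiMinus, smul_comm]
  · rw [smul_mul_smul_comm, smul_mul_smul_comm, ← smul_add, antiMinus_mul_antiPlus_add,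
      imag_mul_imag, neg_smul, one_smul, ← smul_neg, neg_sub]
  · rw [smul_mul_smul_comm, smul_mul_smul_comm, antiPlus_mul_antiPlus q δ c hg, smul_neg, smul_comm]
  · rw [smul_mul_smul_comm, smul_mul_smul_comm, antiMinus_mul_antiMinus q δ c hg, smul_neg,
      smul_comm]

end Antipode

/-! ### The antipode as a graded anti-homomorphism -/

section AntipodeMap

variable {R : Type u} [CommRing R] [Algebra ℂ R] (q : ℂˣ) {g : ℂˣ → ℂˣ} (δ : ℂˣ → R)
  {c c' : ℂ} (hg : ∀ z, g z = (g z⁻¹)⁻¹) (hc : c' = -c)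

open MulOpposite (op unop)

local notation "E(" c "," x ")" => mk q g δ c x

/-- The ordinary anti-homomorphism that agrees with `(-i) ^ deg` times the antipode. -/
noncomputable def antiHom : U q g δ c' →ₐ[R] (U q g δ c)ᵐᵒᵖ :=
  (antiGen_isRealization q δ c hg hc).lift

theorem antiHom_mk (x : Gen) : antiHom q δ hg hc E(c',x) = antiGen q g δ c x :=
  IsRealization.lift_mk _ x

theorem unop_antiHom_parity (a : U q g δ c') :
    unop (antiHom q δ hg hc (parity q g δ c' a)) =
      parity q g δ c (unop (antiHom q δ hg hc a)) := by
  induction a using U_induction with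
  | halg r => simp only [AlgHom.commutes, MulOpposite.algebraMap_apply, MulOpposite.unop_op]
  | hgen x =>
    rw [parity_mk, map_smul, antiHom_mk]
    cases x <;> simp [antiGen, antiPlus, antiMinus, parity_mk, Gen.sign]
  | hmul a b ha hb =>
    rw [map_mul, map_mul, map_mul, MulOpposite.unop_mul, MulOpposite.unop_mul, map_mul, ha, hb]
  | hadd a b ha hb =>
    rw [map_add, map_add, map_add, MulOpposite.unop_add, MulOpposite.unop_add, map_add, ha, hb]

/-- The antipode. -/
noncomputable def antipode : U q g δ c' →ₗ[R] U q g δ c :=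
  (MulOpposite.opLinearEquiv R).symm.toLinearMap ∘ₗ (antiHom q δ hg hc).toLinearMap ∘ₗ
    -- The factor `i` on the odd part undoes the `-i` built into `antiHom`.
    ((grading q g δ c' 0).subtype ∘ₗ proj q g δ c' 0 +
      imag R • (grading q g δ c' 1).subtype ∘ₗ proj q g δ c' 1)

theorem proj_of_mem {i j : ZMod 2} (hij : i ≠ j) {a : U q g δ c} (ha : a ∈ grading q g δ c i) :
    (proj q g δ c j a : U q g δ c) = 0 := by
  have hz : ∀ i : ZMod 2, i = 0 ∨ i = 1 := by decide
  have h := proj_add_proj q g δ c a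
  have h' := proj_same q g δ c i ⟨a, ha⟩
  obtain rfl | rfl := hz i <;> obtain rfl | rfl := hz j
  · exact absurd rfl hij
  · rw [h'] at h; simpa using h
  · rw [h'] at h; simpa using h
  · exact absurd rfl hij

variable {q δ}

theorem antipode_of_even {a : U q g δ c'} (ha : a ∈ grading q g δ c' 0) :
    antipode q δ hg hc a = unop (antiHom q δ hg hc a) := by
  have h₀ := proj_same q g δ c' 0 ⟨a, ha⟩
  have h₁ := proj_of_mem q δ zero_ne_one ha
  simp only at h₀
  simp [antipode, h₀, h₁]

theorem antipode_of_odd {a : U q g δ c'} (ha : a ∈ grading q g δ c' 1) :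
    antipode q δ hg hc a = imag R • unop (antiHom q δ hg hc a) := by
  have h₀ := proj_of_mem q δ one_ne_zero ha
  have h₁ := proj_same q g δ c' 1 ⟨a, ha⟩
  simp only at h₁
  simp [antipode, h₀, h₁]

theorem antipode_mem (i : ZMod 2) {a : U q g δ c'} (ha : a ∈ grading q g δ c' i) :
    antipode q δ hg hc a ∈ grading q g δ c i := by
  have hz : ∀ i : ZMod 2, i = 0 ∨ i = 1 := by decide
  have h := unop_antiHom_parity q δ hg hc a
  obtain rfl | rfl := hz i
  · rw [parity_of_even ha] at h
    rw [antipode_of_even hg hc ha, mem_even_iff, ← h]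
  · rw [parity_of_odd ha, map_neg, MulOpposite.unop_neg] at h
    rw [antipode_of_odd hg hc ha, mem_odd_iff, map_smul, ← h, smul_neg]

/-- Only the odd-odd case carries a sign: the product is even and gets no factor `i`, while the two
factors together contribute `i * i = -1`. -/
theorem antipode_mul (i j : ZMod 2) {a b : U q g δ c'} (ha : a ∈ grading q g δ c' i)
    (hb : b ∈ grading q g δ c' j) :
    antipode q δ hg hc (a * b) =
      ((-1 : ℤˣ) ^ (i * j)) • (antipode q δ hg hc b * antipode q δ hg hc a) := by
  have hz : ∀ i : ZMod 2, i = 0 ∨ i = 1 := by decide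
  have hab : a * b ∈ grading q g δ c' (i + j) := SetLike.mul_mem_graded ha hb
  obtain rfl | rfl := hz i <;> obtain rfl | rfl := hz j
  · rw [antipode_of_even hg hc hab, antipode_of_even hg hc ha, antipode_of_even hg hc hb]
    simp
  · rw [antipode_of_odd hg hc hab, antipode_of_even hg hc ha, antipode_of_odd hg hc hb]
    simp
  · rw [antipode_of_odd hg hc hab, antipode_of_odd hg hc ha, antipode_of_even hg hc hb]
    simp
  · rw [antipode_of_even hg hc hab, antipode_of_odd hg hc ha, antipode_of_odd hg hc hb,
      smul_mul_smul_comm, imag_mul_imag]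
    simp

theorem antipode_mul_of_even_left {a : U q g δ c'} (ha : a ∈ grading q g δ c' 0) (b : U q g δ c') :
    antipode q δ hg hc (a * b) = antipode q δ hg hc b * antipode q δ hg hc a := by
  obtain ⟨b₀, h₀, b₁, h₁, rfl⟩ := exists_even_add_odd b
  rw [mul_add, map_add, antipode_mul hg hc 0 0 ha h₀, antipode_mul hg hc 0 1 ha h₁, map_add,
    add_mul]
  simp

/-- The sign is again absorbed into `σ`, in the same shape as the sign of `tmul_mul_tmul_of_odd`, so
the two match in the antipode axioms. -/
theorem antipode_mul_of_odd_left {a : U q g δ c'} (ha : a ∈ grading q g δ c' 1) (b : U q g δ c') :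
    antipode q δ hg hc (a * b) =
      antipode q δ hg hc (parity q g δ c' b) * antipode q δ hg hc a := by
  obtain ⟨b₀, h₀, b₁, h₁, rfl⟩ := exists_even_add_odd b
  rw [mul_add, map_add, antipode_mul hg hc 1 0 ha h₀, antipode_mul hg hc 1 1 ha h₁, map_add,
    parity_of_even h₀, parity_of_odd h₁, map_add, map_neg, add_mul]
  simp

theorem antipode_mul_of_even_right {b : U q g δ c'} (hb : b ∈ grading q g δ c' 0) (a : U q g δ c') :
    antipode q δ hg hc (a * b) = antipode q δ hg hc b * antipode q δ hg hc a := by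
  obtain ⟨a₀, h₀, a₁, h₁, rfl⟩ := exists_even_add_odd a
  rw [add_mul, map_add, antipode_mul hg hc 0 0 h₀ hb, antipode_mul hg hc 1 0 h₁ hb, map_add,
    mul_add]
  simp

theorem antipode_mul_of_odd_right {b : U q g δ c'} (hb : b ∈ grading q g δ c' 1) (a : U q g δ c') :
    antipode q δ hg hc (a * b) =
      antipode q δ hg hc b * antipode q δ hg hc (parity q g δ c' a) := by
  obtain ⟨a₀, h₀, a₁, h₁, rfl⟩ := exists_even_add_odd a
  rw [add_mul, map_add, antipode_mul hg hc 0 1 h₀ hb, antipode_mul hg hc 1 1 h₁ hb, map_add,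
    parity_of_even h₀, parity_of_odd h₁, map_add, map_neg, mul_add]
  simp

theorem antipode_algebraMap (r : R) :
    antipode q δ hg hc (algebraMap R _ r) = algebraMap R _ r := by
  rw [antipode_of_even hg hc (by rw [mem_even_iff, AlgHom.commutes]), AlgHom.commutes]
  rfl

theorem antipode_xPlus (z : ℂˣ) :
    antipode q δ hg hc E(c',.xPlus z) = -antiPlus q g δ c z := by
  rw [antipode_of_odd hg hc (mk_xPlus_mem z), antiHom_mk, antiGen, MulOpposite.unop_op,
    smul_smul, imag_mul_imag]
  simp

theorem antipode_xMinus (z : ℂˣ) :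
    antipode q δ hg hc E(c',.xMinus z) = -antiMinus q g δ c z := by
  rw [antipode_of_odd hg hc (mk_xMinus_mem z), antiHom_mk, antiGen, MulOpposite.unop_op,
    smul_smul, imag_mul_imag]
  simp

theorem antipode_phi (z : ℂˣ) : antipode q δ hg hc E(c',.phi z) = E(c,.phiInv z) := by
  rw [antipode_of_even hg hc (mk_phi_mem z), antiHom_mk, antiGen, MulOpposite.unop_op]

theorem antipode_phiInv (z : ℂˣ) : antipode q δ hg hc E(c',.phiInv z) = E(c,.phi z) := by
  rw [antipode_of_even hg hc (phiInv_mem z), antiHom_mk, antiGen, MulOpposite.unop_op]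

theorem antipode_psi (z : ℂˣ) : antipode q δ hg hc E(c',.psi z) = E(c,.psiInv z) := by
  rw [antipode_of_even hg hc (mk_psi_mem z), antiHom_mk, antiGen, MulOpposite.unop_op]

theorem antipode_psiInv (z : ℂˣ) : antipode q δ hg hc E(c',.psiInv z) = E(c,.psi z) := by
  rw [antipode_of_even hg hc (psiInv_mem z), antiHom_mk, antiGen, MulOpposite.unop_op]

theorem antipode_one : antipode q δ hg hc (1 : U q g δ c') = 1 := by
  simpa using antipode_algebraMap hg hc (q := q) (δ := δ) (1 : R)

end AntipodeMap

/-! ### The antipode axioms and the assembled Hopf structure -/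

section AntipodeAxioms

open GradedTensorProduct (tmul)

variable {R : Type u} [CommRing R] [Algebra ℂ R] (q : ℂˣ) {g : ℂˣ → ℂˣ} (δ : ℂˣ → R)
  {c₁ c₂ : ℂ} (hg : ∀ z, g z = (g z⁻¹)⁻¹)

local notation "E(" c "," x ")" => mk q g δ c x

/-- `m ∘ (a ⊗ id)`. -/
noncomputable def antipodeLeft (h' : c₁ = -c₂) :
    grading q g δ c₁ ᵍ⊗[R] grading q g δ c₂ →ₗ[R] U q g δ c₂ :=
  LinearMap.mul' R (U q g δ c₂) ∘ₗ TensorProduct.map (antipode q δ hg h') LinearMap.id ∘ₗ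
    (GradedTensorProduct.of R (grading q g δ c₁) (grading q g δ c₂)).symm.toLinearMap

/-- `m ∘ (id ⊗ a)`. -/
noncomputable def antipodeRight (h' : c₂ = -c₁) :
    grading q g δ c₁ ᵍ⊗[R] grading q g δ c₂ →ₗ[R] U q g δ c₁ :=
  LinearMap.mul' R (U q g δ c₁) ∘ₗ TensorProduct.map LinearMap.id (antipode q δ hg h') ∘ₗ
    (GradedTensorProduct.of R (grading q g δ c₁) (grading q g δ c₂)).symm.toLinearMap

theorem antipodeLeft_tmul (h' : c₁ = -c₂) (a : U q g δ c₁) (b : U q g δ c₂) :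
    antipodeLeft q δ hg h' (tmul R a b) = antipode q δ hg h' a * b := rfl

theorem antipodeRight_tmul (h' : c₂ = -c₁) (a : U q g δ c₁) (b : U q g δ c₂) :
    antipodeRight q δ hg h' (tmul R a b) = a * antipode q δ hg h' b := rfl

/-- As the antipode reverses products, multiplying by `Δ(x)` on the left inserts its two legs next
to each other in the middle, between the images of the legs of `u`. There they collapse to the
scalar `ε(x)`. -/
theorem antipodeLeft_comulGen_mul (h' : c₁ = -c₂) (x : Gen)
    (u : grading q g δ c₁ ᵍ⊗[R] grading q g δ c₂) :
    antipodeLeft q δ hg h' (comulGen q g δ c₁ c₂ x * u) =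
      counitGen R x • antipodeLeft q δ hg h' u := by
  subst h'
  induction u using tensor_induction with
  | hadd s t hs ht => rw [mul_add, map_add, hs, ht, map_add, smul_add]
  | htmul a b =>
    cases x with
    | xPlus z =>
      rw [comulGen, add_mul, tmul_mul_tmul_of_even one_mem_grading,
        tmul_mul_tmul_of_odd (mk_xPlus_mem _), map_add, antipodeLeft_tmul, antipodeLeft_tmul,
        antipode_mul_of_odd_left _ _ (mk_xPlus_mem _),
        antipode_mul_of_even_left _ _ (mk_phi_mem _), antipode_xPlus, antipode_phi, antiPlus,
        neg_div, counitGen, zero_smul]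
      simp only [mul_neg, neg_mul, one_mul, mul_assoc]
      exact neg_add_cancel _
    | xMinus z =>
      rw [comulGen, add_mul, tmul_mul_tmul_of_even (mk_psi_mem _),
        tmul_mul_tmul_of_odd (mk_xMinus_mem _), map_add, antipodeLeft_tmul, antipodeLeft_tmul,
        antipode_mul_of_odd_left _ _ (mk_xMinus_mem _), antipode_xMinus, antiMinus,
        mul_qPow_mul_qPow, mul_qPow_mul_qPow, add_neg_cancel,
        show c₂ + -(c₂ / 2) = c₂ / 2 by ring, qPow_zero, mul_one, counitGen, zero_smul]
      simp only [mul_neg, neg_mul, one_mul, mul_assoc]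
      rw [← mul_assoc E(c₂,.psiInv _), psiInv_mul_psi, one_mul, add_neg_cancel]
    | phi z =>
      rw [comulGen, tmul_mul_tmul_of_even (mk_phi_mem _), antipodeLeft_tmul, antipodeLeft_tmul,
        antipode_mul_of_even_left _ _ (mk_phi_mem _), antipode_phi, neg_div, mul_assoc,
        ← mul_assoc E(c₂,.phiInv _), phiInv_mul_phi, one_mul, counitGen, one_smul]
    | phiInv z =>
      rw [comulGen, tmul_mul_tmul_of_even (phiInv_mem _), antipodeLeft_tmul, antipodeLeft_tmul,
        antipode_mul_of_even_left _ _ (phiInv_mem _), antipode_phiInv, neg_div, mul_assoc,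
        ← mul_assoc E(c₂,.phi _), phi_mul_phiInv, one_mul, counitGen, one_smul]
    | psi z =>
      rw [comulGen, tmul_mul_tmul_of_even (mk_psi_mem _), antipodeLeft_tmul, antipodeLeft_tmul,
        antipode_mul_of_even_left _ _ (mk_psi_mem _), antipode_psi, neg_div, neg_neg, mul_assoc,
        ← mul_assoc E(c₂,.psiInv _), psiInv_mul_psi, one_mul, counitGen, one_smul]
    | psiInv z =>
      rw [comulGen, tmul_mul_tmul_of_even (psiInv_mem _), antipodeLeft_tmul, antipodeLeft_tmul,
        antipode_mul_of_even_left _ _ (psiInv_mem _), antipode_psiInv, neg_div, neg_neg, mul_assoc,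
        ← mul_assoc E(c₂,.psi _), psi_mul_psiInv, one_mul, counitGen, one_smul]

/-- For `m ∘ (id ⊗ a)` it is multiplication on the right that puts the legs of `Δ(x)` in the middle.
-/
theorem antipodeRight_mul_comulGen (h' : c₂ = -c₁) (x : Gen)
    (u : grading q g δ c₁ ᵍ⊗[R] grading q g δ c₂) :
    antipodeRight q δ hg h' (u * comulGen q g δ c₁ c₂ x) =
      counitGen R x • antipodeRight q δ hg h' u := by
  subst h'
  induction u using tensor_induction with
  | hadd s t hs ht => rw [add_mul, map_add, hs, ht, map_add, smul_add]
  | htmul a b =>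
    cases x with
    | xPlus z =>
      rw [comulGen, mul_add, tmul_mul_tmul_of_odd_left (mk_xPlus_mem _),
        tmul_mul_tmul_of_even_left (mk_phi_mem _), map_add, antipodeRight_tmul, antipodeRight_tmul,
        antipode_mul_of_odd_right _ _ (mk_xPlus_mem _), antipode_xPlus, antiPlus,
        mul_qPow_mul_qPow, mul_qPow_mul_qPow, add_neg_cancel,
        show c₁ + -(c₁ / 2) = c₁ / 2 by ring, qPow_zero, mul_one, mul_one, counitGen, zero_smul]
      simp only [mul_neg, neg_mul, mul_assoc]
      rw [← mul_assoc E(c₁,.phi _), phi_mul_phiInv, one_mul, add_neg_cancel]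
    | xMinus z =>
      rw [comulGen, mul_add, tmul_mul_tmul_of_odd_left (mk_xMinus_mem _),
        tmul_mul_tmul_of_even_left one_mem_grading, map_add, antipodeRight_tmul, antipodeRight_tmul,
        antipode_mul_of_odd_right _ _ (mk_xMinus_mem _),
        antipode_mul_of_even_right _ _ (mk_psi_mem _), antipode_xMinus, antipode_psi, antiMinus,
        neg_div, counitGen, zero_smul, mul_one]
      simp only [mul_neg, neg_mul, mul_assoc]
      exact neg_add_cancel _
    | phi z =>
      rw [comulGen, tmul_mul_tmul_of_even_left (mk_phi_mem _), antipodeRight_tmul,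
        antipodeRight_tmul, antipode_mul_of_even_right _ _ (mk_phi_mem _), antipode_phi, neg_div,
        neg_neg, mul_assoc, ← mul_assoc E(c₁,.phi _), phi_mul_phiInv, one_mul, counitGen, one_smul]
    | phiInv z =>
      rw [comulGen, tmul_mul_tmul_of_even_left (phiInv_mem _), antipodeRight_tmul,
        antipodeRight_tmul, antipode_mul_of_even_right _ _ (phiInv_mem _), antipode_phiInv, neg_div,
        neg_neg, mul_assoc, ← mul_assoc E(c₁,.phiInv _), phiInv_mul_phi, one_mul, counitGen,
        one_smul]
    | psi z =>
      rw [comulGen, tmul_mul_tmul_of_even_left (mk_psi_mem _), antipodeRight_tmul,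
        antipodeRight_tmul, antipode_mul_of_even_right _ _ (mk_psi_mem _), antipode_psi, neg_div,
        mul_assoc, ← mul_assoc E(c₁,.psi _), psi_mul_psiInv, one_mul, counitGen, one_smul]
    | psiInv z =>
      rw [comulGen, tmul_mul_tmul_of_even_left (psiInv_mem _), antipodeRight_tmul,
        antipodeRight_tmul, antipode_mul_of_even_right _ _ (psiInv_mem _), antipode_psiInv, neg_div,
        mul_assoc, ← mul_assoc E(c₁,.psiInv _), psiInv_mul_psi, one_mul, counitGen, one_smul]

theorem antipodeLeft_comul (h : 0 = c₁ + c₂) (h' : c₁ = -c₂) (a : U q g δ 0) :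
    antipodeLeft q δ hg h' (comul q δ c₁ c₂ hg h a) = algebraMap R _ (counit q g δ a) := by
  have key : ∀ u, antipodeLeft q δ hg h' (comul q δ c₁ c₂ hg h a * u) =
      counit q g δ a • antipodeLeft q δ hg h' u := by
    induction a using U_induction with
    | halg r =>
      intro u
      rw [AlgHom.commutes, ← Algebra.smul_def, map_smul, AlgHom.commutes,
        Algebra.algebraMap_self_apply]
    | hgen x => intro u; rw [comul_mk, antipodeLeft_comulGen_mul, counit_mk]
    | hmul a b ha hb =>
      intro u
      rw [map_mul (comul q δ _ _ hg _), mul_assoc, ha, hb, map_mul, mul_smul]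
    | hadd a b ha hb => intro u; rw [map_add, add_mul, map_add, ha, hb, map_add, add_smul]
  have h1 := key 1
  rwa [mul_one, ← one_tmul_one, antipodeLeft_tmul, antipode_one, one_mul,
    ← Algebra.algebraMap_eq_smul_one] at h1

theorem antipodeRight_comul (h : 0 = c₁ + c₂) (h' : c₂ = -c₁) (a : U q g δ 0) :
    antipodeRight q δ hg h' (comul q δ c₁ c₂ hg h a) = algebraMap R _ (counit q g δ a) := by
  have key : ∀ u, antipodeRight q δ hg h' (u * comul q δ c₁ c₂ hg h a) =
      counit q g δ a • antipodeRight q δ hg h' u := by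
    induction a using U_induction with
    | halg r =>
      intro u
      rw [AlgHom.commutes, ← Algebra.commutes, ← Algebra.smul_def, map_smul, AlgHom.commutes,
        Algebra.algebraMap_self_apply]
    | hgen x => intro u; rw [comul_mk, antipodeRight_mul_comulGen, counit_mk]
    | hmul a b ha hb =>
      intro u
      -- The right factor `b` is stripped first, so the counits come out in reverse order; `R` is
      -- commutative.
      rw [map_mul (comul q δ _ _ hg _), ← mul_assoc, hb, ha, map_mul, mul_comm, mul_smul]
    | hadd a b ha hb => intro u; rw [map_add, mul_add, map_add, ha, hb, map_add, add_smul]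
  have h1 := key 1
  rwa [one_mul, ← one_tmul_one, antipodeRight_tmul, antipode_one, mul_one,
    ← Algebra.algebraMap_eq_smul_one] at h1

/-- The graded Hopf structure on `U_q(g, fs)`. -/
noncomputable def hopf : GradedHopfStructure R (fun c => U q g δ c) (fun c => grading q g δ c) where
  comul _ c₁ c₂ h := comul q δ c₁ c₂ hg h
  counit := counit q g δ
  antipode _ _ h := antipode q δ hg h
  comul_mem _ c₁ c₂ h i _ ha := comul_mem q g δ c₁ c₂ hg h i ha
  counit_odd _ ha := counit_of_odd q g δ ha
  antipode_mem _ _ h i _ ha := antipode_mem hg h i ha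
  coassoc _ _ _ _ _ _ h₁₂ h₂₃ h h' a := coassoc q δ hg h₁₂ h₂₃ h h' a
  counit_left c h a := counitLeft_comul q δ c hg h a
  counit_right c h a := counitRight_comul q δ c hg h a
  antipode_left _ _ h h' a := antipodeLeft_comul q δ hg h h' a
  antipode_right _ _ h h' a := antipodeRight_comul q δ hg h h' a
  antipode_mul _ _ h i j _ _ ha hb := antipode_mul hg h i j ha hb

end AntipodeAxioms

end FunctionalSuperalgebra

/-! ### The main theorem -/

open FunctionalSuperalgebra in
theorem mainTheorem3 {R : Type u} [CommRing R] [Algebra ℂ R]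
    (q : ℂˣ) (hq : (q : ℂ) ^ 2 ≠ 1)
    (g : ℂˣ → ℂˣ) (hg : ∀ z, g z = (g z⁻¹)⁻¹)
    (δ : ℂˣ → R) (hδ : ∀ z, z ≠ 1 → δ z = 0) :
    ∃ H : GradedHopfStructure R (fun c => U q g δ c) (fun c => grading q g δ c),
      -- coproduct
      (∀ (c c₁ c₂ : ℂ) (h : c = c₁ + c₂),
        H.comul c c₁ c₂ h (central q g δ c) =
          GradedTensorProduct.tmul R (central q g δ c₁) 1 +
            GradedTensorProduct.tmul R 1 (central q g δ c₂) ∧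
        (∀ s : ℂ, H.comul c c₁ c₂ h (qPowCentral q g δ c s) =
          GradedTensorProduct.tmul R (qPowCentral q g δ c₁ s) (qPowCentral q g δ c₂ s)) ∧
        ∀ z : ℂˣ,
          H.comul c c₁ c₂ h (xPlus q g δ c z) =
            GradedTensorProduct.tmul R (xPlus q g δ c₁ z) 1 +
              GradedTensorProduct.tmul R (phi q g δ c₁ (z * qPow q (c₁ / 2)) : U q g δ c₁)
                (xPlus q g δ c₂ (z * qPow q c₁)) ∧
          H.comul c c₁ c₂ h (xMinus q g δ c z) =
            GradedTensorProduct.tmul R 1 (xMinus q g δ c₂ z) +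
              GradedTensorProduct.tmul R (xMinus q g δ c₁ (z * qPow q c₂))
                (psi q g δ c₂ (z * qPow q (c₂ / 2)) : U q g δ c₂) ∧
          H.comul c c₁ c₂ h (phi q g δ c z) =
            GradedTensorProduct.tmul R (phi q g δ c₁ (z * qPow q (-(c₂ / 2))) : U q g δ c₁)
              (phi q g δ c₂ (z * qPow q (c₁ / 2)) : U q g δ c₂) ∧
          H.comul c c₁ c₂ h (psi q g δ c z) =
            GradedTensorProduct.tmul R (psi q g δ c₁ (z * qPow q (c₂ / 2)) : U q g δ c₁)
              (psi q g δ c₂ (z * qPow q (-(c₁ / 2))) : U q g δ c₂)) ∧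
      -- counit
      (H.counit (central q g δ 0) = 0 ∧
        (∀ s : ℂ, H.counit (qPowCentral q g δ 0 s) = 1) ∧
        ∀ z : ℂˣ,
          H.counit (phi q g δ 0 z) = 1 ∧ H.counit (psi q g δ 0 z) = 1 ∧
          H.counit (xPlus q g δ 0 z) = 0 ∧ H.counit (xMinus q g δ 0 z) = 0) ∧
      -- antipode: in the formulas `c` is the central element of the algebra in which they hold
      (∀ (c' c : ℂ) (h : c' = -c),
        H.antipode c' c h (central q g δ c') = -central q g δ c ∧
        (∀ s : ℂ, H.antipode c' c h (qPowCentral q g δ c' s) = qPowCentral q g δ c (-s)) ∧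
        ∀ z : ℂˣ,
          H.antipode c' c h (xPlus q g δ c' z) =
            -(((phi q g δ c (z * qPow q (-(c / 2))))⁻¹ : (U q g δ c)ˣ) *
              xPlus q g δ c (z * qPow q (-c))) ∧
          H.antipode c' c h (xMinus q g δ c' z) =
            -(xMinus q g δ c (z * qPow q (-c)) *
              ((psi q g δ c (z * qPow q (-(c / 2))))⁻¹ : (U q g δ c)ˣ)) ∧
          H.antipode c' c h (phi q g δ c' z) = ((phi q g δ c z)⁻¹ : (U q g δ c)ˣ) ∧
          H.antipode c' c h (psi q g δ c' z) = ((psi q g δ c z)⁻¹ : (U q g δ c)ˣ)) := by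
  refine ⟨hopf q δ hg, fun c c₁ c₂ h => ⟨?_, fun s => ?_, fun z => ⟨comul_mk q δ c₁ c₂ hg h _,
    comul_mk q δ c₁ c₂ hg h _, comul_mk q δ c₁ c₂ hg h _, comul_mk q δ c₁ c₂ hg h _⟩⟩,
    ⟨?_, fun s => ?_, fun z => ⟨counit_mk q g δ _, counit_mk q g δ _, counit_mk q g δ _,
      counit_mk q g δ _⟩⟩,
    fun c' c h => ⟨?_, fun s => ?_, fun z => ⟨antipode_xPlus hg h z, antipode_xMinus hg h z,
      antipode_phi hg h z, antipode_psi hg h z⟩⟩⟩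
  -- The central elements are scalars, so their formulas follow from `R`-linearity; here `c₁ + c₂`
  -- is split by placing one scalar in each leg.
  · change comul q δ c₁ c₂ hg h (algebraMap R _ _) = _
    rw [AlgHom.commutes, central, central, h, map_add, map_add,
      GradedTensorProduct.algebraMap_def, GradedTensorProduct.algebraMap_def']
  · change comul q δ c₁ c₂ hg h (algebraMap R _ _) = _
    rw [AlgHom.commutes, qPowCentral, qPowCentral, h, mul_add, qPow_add, Units.val_mul, map_mul,
      map_mul, GradedTensorProduct.algebraMap_def, GradedTensorProduct.algebraMap_def',
      GradedTensorProduct.tmul_one_mul_one_tmul]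
  · change counit q g δ (algebraMap R _ _) = _
    rw [AlgHom.commutes, map_zero, map_zero]
  · change counit q g δ (algebraMap R _ _) = _
    rw [AlgHom.commutes, mul_zero, qPow_zero, Units.val_one, map_one, map_one]
  · change antipode q δ hg h (algebraMap R _ _) = _
    rw [antipode_algebraMap, central, h, map_neg, map_neg]
  · change antipode q δ hg h (algebraMap R _ _) = _
    rw [antipode_algebraMap, qPowCentral, h, mul_neg, neg_mul]
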